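/- Let $q$ be an odd prime power and let $h$ be an even positive integer with $\frac{q-1}{h}=2\tau+1$ for some integer $\tau\ge 1$. Let $r\geq 1$ be an integer, put $m=\frac{q^2-1}{2h}$ and $n=rm+1$, let $\theta$ be a primitive element of $\mathbb F_{q^2}$, and let $\gamma=\theta^{2h}$, which has order $m$. An $[[n,\kappa,d]]_q$ quantum code is a subspace $Q$ of $(\mathbb C^q)^{\otimes n}$ of dimension $q^\kappa$ with minimum distance $d$: if $P$ denotes the orthogonal projection onto $Q$, then $d$ is the least number of tensor factors on which an operator $E$ with $PEP\notin\mathbb C P$ can act. It is a quantum MDS code if $2d=n-\kappa+2$. 1. If $\frac h2+1\le r\le h$, then for every integer $k$ with $1\le k\le (h+1)\frac{q-1}{2h}+\frac12$ there exists an $[[n,n-2k,k+1]]_q$ quantum MDS code. 2. If $r$ is odd and $h<r<2h$, then for every integer $k$ with $1\le k\le r\frac{q-1}{2h}+\frac12$ there exists an $[[n,n-2k,k+1]]_q$ quantum MDS code. Moreover, in both cases the quantum code can be obtained by the Hermitian construction from a generalized Reed–Solomon code $GRS_k(\boldsymbol a,\boldsymbol v)=\{(v_1f(a_1),\dots,v_nf(a_n)):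 f\in\mathbb F_{q^2}[x],\ \deg f\le k-1\}$ with all $v_j\ne0$ that is Hermitian self-orthogonal (that is, $\sum_{j}x_jy_j^q=0$ for all its codewords $x,y$), and whose distinct locators $a_1,\dots,a_n$ are the elements of $\{0\}\cup\bigcup_{l=1}^{r}\theta^{i_l}\langle\gamma\rangle$ for some integers $i_1,\dots,i_r$ distinct modulo $2h$. Here a quantum code is obtained by the Hermitian construction from a linear code $C\subseteq\mathbb F_{q^2}^n$ if, for some $\mathbb F_q$-basis $(e_0,e_1)$ of $\mathbb F_{q^2}$ and some nontrivial additive character $\psi$ of $\mathbb F_q$, it is a nonzero common eigenspace of the operators $|x\rangle\mapsto\psi\big(t\cdot(x+s)\big)\,|x+s\rangle$ ($x\in\mathbb F_q^n$), where $(s,t)$ runs over the pairs in $\mathbb F_q^n\times\mathbb F_q^n$ with $e_0s+e_1t\in C$. -/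

import Mathlib

noncomputable section

/-! ### Quantum codes -/

/-- The Hilbert space `(ℂ^q)^{⊗ n}` of `n` qudits, with orthonormal basis `|x⟩`, `x ∈ Aⁿ`,
where the alphabet `A` has `q` elements. -/
abbrev QuditSpace (A : Type*) [Fintype A] (n : ℕ) : Type _ := EuclideanSpace ℂ (Fin n → A)

/-- An operator on `n` qudits, given by its matrix in the basis `|x⟩`. -/
abbrev QuditOp (A : Type*) (n : ℕ) : Type _ := Matrix (Fin n → A) (Fin n → A) ℂ

/-- The operator `E` acts only on the qudits in `S`: it has the form `M ⊗ 1`, where `M` is an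
arbitrary operator on the qudits in `S` and `1` is the identity on the other qudits. -/
def QuditOp.ActsOn {A : Type*} {n : ℕ} (E : QuditOp A n) (S : Finset (Fin n)) : Prop :=
  ∃ M : Matrix (S → A) (S → A) ℂ,
    (∀ x y : Fin n → A, (∀ i, i ∉ S → x i = y i) →
      E x y = M (fun i => x i.1) (fun i => y i.1)) ∧
    (∀ x y : Fin n → A, ¬ (∀ i, i ∉ S → x i = y i) → E x y = 0)

/-- The code `Q` detects the error `E`: `P E P = c P` for some scalar `c`, where `P` is the
orthogonal projection onto `Q` (the Knill–Laflamme condition). -/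
def Detects {A : Type*} [Fintype A] {n : ℕ} (Q : Submodule ℂ (QuditSpace A n))
    (E : QuditOp A n) : Prop :=
  ∃ c : ℂ, ∀ u ∈ Q, ∀ v ∈ Q,
    inner ℂ u (WithLp.toLp 2 (E.mulVec v.ofLp) : QuditSpace A n) = c * inner ℂ u v

/-- `d` is the minimum distance of `Q`: the least number of qudits on which an error that `Q`
does not detect can act. (This is the notion for codes of dimension at least two; a
one-dimensional code detects every error.) -/
def HasMinDistance {A : Type*} [Fintype A] {n : ℕ} (Q : Submodule ℂ (QuditSpace A n))
    (d : ℕ) : Prop :=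
  IsLeast {w : ℕ | ∃ (S : Finset (Fin n)) (E : QuditOp A n),
    S.card = w ∧ E.ActsOn S ∧ ¬ Detects Q E} d

/-- `Q` is an `[[n, κ, d]]_q` quantum code, with `q` the size of the alphabet: a subspace of
dimension `q ^ κ` of the space of `n` qudits, of minimum distance `d`. -/
structure IsQuantumCode {A : Type*} [Fintype A] {n : ℕ} (Q : Submodule ℂ (QuditSpace A n))
    (κ d : ℕ) : Prop where
  finrank_eq : Module.finrank ℂ Q = Fintype.card A ^ κ
  minDistance : HasMinDistance Q d

/-- `Q` is an `[[n, κ, d]]_q` quantum MDS code: it attains the quantum Singleton bound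
`2 d ≤ n - κ + 2`. -/
structure IsQuantumMDSCode {A : Type*} [Fintype A] {n : ℕ} (Q : Submodule ℂ (QuditSpace A n))
    (κ d : ℕ) : Prop extends IsQuantumCode Q κ d where
  singleton_eq : 2 * d + κ = n + 2

/-! ### Generalized Reed–Solomon codes and Hermitian self-orthogonality -/

/-- The Hermitian inner product `∑ xᵢ yᵢ^q`. -/
def hermInner {K : Type*} [Field K] {n : ℕ} (q : ℕ) (x y : Fin n → K) : K :=
  ∑ i, x i * y i ^ q

/-- The Hermitian dual of a linear code, as a set. -/
def hermDual {K : Type*} [Field K] {n : ℕ} (q : ℕ) (C : Submodule K (Fin n → K)) :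
    Set (Fin n → K) :=
  {x | ∀ y ∈ C, hermInner q x y = 0}

/-- `C` is Hermitian self-orthogonal. -/
def IsHermSelfOrthogonal {K : Type*} [Field K] {n : ℕ} (q : ℕ)
    (C : Submodule K (Fin n → K)) : Prop :=
  (C : Set (Fin n → K)) ⊆ hermDual q C

/-- The code `GRS_k(a, v)` of all `(v₁ f(a₁), …, vₙ f(aₙ))` with `deg f ≤ k - 1`. -/
def grsCode {K : Type*} [Field K] {n : ℕ} (k : ℕ) (a v : Fin n → K) :
    Submodule K (Fin n → K) :=
  (Polynomial.degreeLT K k).map (LinearMap.pi fun i => v i • Polynomial.leval (a i))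

/-! ### The Hermitian construction -/

/-- The error operator `Z(w₁) X(w₀)` on `n` qudits with alphabet `F`, where
`X(s)|x⟩ = |x + s⟩`, `Z(t)|x⟩ = ψ(t · x)|x⟩`, and `w₀, w₁ ∈ Fⁿ` are the coordinate vectors of
`w ∈ Kⁿ` in the `F`-basis `b` of `K`. -/
def weylOp {F K : Type*} [Field F] [Fintype F] [Field K] [Algebra F K] {n : ℕ}
    (b : Module.Basis (Fin 2) F K) (ψ : AddChar F ℂ) (w : Fin n → K)
    (φ : QuditSpace F n) : QuditSpace F n :=
  WithLp.toLp 2 fun x : Fin n → F =>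
    ψ (∑ i, b.repr (w i) 1 * x i) * φ (x - fun i => b.repr (w i) 0)

/-- `Q` is a stabilizer code that the Hermitian construction yields from the linear code `C`
over the quadratic extension `K` of `F`: a nonzero common eigenspace of the error operators
that belong to the codewords of `C`, under an identification of `K` with `F²` by an `F`-basis
and with a nontrivial additive character of `F`. -/
def IsHermitianConstruction {F K : Type*} [Field F] [Fintype F] [Field K] [Algebra F K] {n : ℕ}
    (C : Submodule K (Fin n → K)) (Q : Submodule ℂ (QuditSpace F n)) : Prop :=
  Q ≠ ⊥ ∧ ∃ (b : Module.Basis (Fin 2) F K) (ψ : AddChar F ℂ) (c : (Fin n → K) → ℂ),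
    ψ ≠ 1 ∧ ∀ φ : QuditSpace F n, φ ∈ Q ↔ ∀ w ∈ C, weylOp b ψ w φ = c w • φ

/-- There is an `[[n, n - 2k, k + 1]]_q` quantum MDS code, where `q = |F|`, that the Hermitian
construction yields from a Hermitian self-orthogonal code `GRS_k(a, v)` whose locators are `0`
and the elements of `r` distinct cosets `θ^{i_l} ⟨γ⟩`, with `γ = θ^{2h}`.
The Singleton equality in `IsQuantumMDSCode` forces `n - 2 * k` to be the true difference. -/
def ExistsQuantumMDSFromGRS (F : Type*) {K : Type*} [Field F] [Fintype F] [Field K] [Algebra F K]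
    (θ : Kˣ) (h r n k : ℕ) : Prop :=
  ∃ (e : Fin r → ℕ) (a v : Fin n → K) (Q : Submodule ℂ (QuditSpace F n)),
    (∀ l l' : Fin r, e l ≡ e l' [MOD 2 * h] → l = l') ∧
    Function.Injective a ∧
    Set.range a = {0} ∪ {x : K | ∃ (l : Fin r) (ν : ℕ), x = θ ^ e l * (θ ^ (2 * h)) ^ ν} ∧
    (∀ i, v i ≠ 0) ∧
    IsHermSelfOrthogonal (Fintype.card F) (grsCode k a v) ∧
    IsHermitianConstruction (grsCode k a v) Q ∧
    IsQuantumMDSCode Q (n - 2 * k) (k + 1)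

end

/-!
Write `q = 2 g c + 1` with `h = 2 g` and `c = 2 τ + 1`, so that `m = c (g c + 1)`.

The Weyl operators of a code `C` that is isotropic for the symplectic form of `F²ⁿ ≃ Kⁿ` can be
rescaled so as to form a group; its space of fixed vectors has dimension `qⁿ / |C|`, by a trace
computation, and its minimum distance is the minimum weight of the words outside `C` that are
symplectically orthogonal to `C`. For a `K`-linear code the symplectic and the Hermitian dual
agree. For a Hermitian self-orthogonal generalized Reed–Solomon code of dimension `k < n / 2` that
minimum weight is `k + 1`, so the quantum code is MDS.

It remains to choose `v`. Every nonzero element of `F` is a norm `v_j ^ (q + 1)`, so it suffices to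
find nonzero weights in `F` on the locators whose `(s + q t)`-th power sums vanish for all
`s, t < k`. We let the weights be constant on the cosets of `⟨γ⟩`. The sum over a coset then
vanishes unless `s + q t = m T`, and the remaining conditions concern the power sums
`∑ w_l ω ^ (i_l T)` with `ω = θ ^ m`; here `ω ^ 2` is a primitive `h`-th root of unity of `F`. The
bound on `k` restricts `T` to few values:

* For `r ≤ h` all relevant `T` are even, and weights on `r` distinct powers of `ω ^ 2` with
  vanishing `T / 2`-th power sums come from Lagrange interpolation.
* For `r = h + s` we use all even powers of `ω`, with weights `v`, and `s` odd powers, with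
  weights `u`. Interpolation gives `u` with few nonvanishing power sums, and inverting a Vandermonde
  matrix gives `v` such that the two contributions cancel for even `T` and both vanish for odd `T`.
-/

/-! ### Weyl operators -/

section Characters

variable {F ι : Type*} [Field F] [Fintype ι] {ψ : AddChar F ℂ}

lemma exists_addChar_dotProduct_ne_one (hψ : ψ ≠ 1) {t : ι → F} (ht : t ≠ 0) :
    ∃ y, ψ (t ⬝ᵥ y) ≠ 1 := by
  classical
  obtain ⟨i, hi⟩ := Function.ne_iff.1 ht
  obtain ⟨a, ha⟩ := AddChar.ne_one_iff.1 (AddChar.IsPrimitive.of_ne_one hψ hi)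
  exact ⟨Pi.single i a, by rwa [dotProduct_single]⟩

/-- The character `y ↦ ψ (t ⬝ᵥ y)` of `F^ι`. -/
noncomputable def dotChar (ψ : AddChar F ℂ) (t : ι → F) : AddChar (ι → F) ℂ :=
  ψ.compAddMonoidHom (dotProductBilin F F t).toAddMonoidHom

lemma dotChar_apply (t y : ι → F) : dotChar ψ t y = ψ (t ⬝ᵥ y) := rfl

lemma dotChar_injective (hψ : ψ ≠ 1) :
    Function.Injective (dotChar ψ : (ι → F) → AddChar (ι → F) ℂ) := by
  intro s t hst
  by_contra hne
  obtain ⟨y, hy⟩ := exists_addChar_dotProduct_ne_one hψ (sub_ne_zero.2 hne)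
  rw [sub_dotProduct, AddChar.map_sub_eq_div, ← dotChar_apply, hst, dotChar_apply,
    div_self (AddChar.val_isUnit _ _).ne_zero] at hy
  exact hy rfl

variable [Fintype (ι → F)]

lemma sum_addChar_dotProduct (hψ : ψ ≠ 1) {t : ι → F} (ht : t ≠ 0) :
    ∑ y, ψ (t ⬝ᵥ y) = 0 := by
  obtain ⟨y, hy⟩ := exists_addChar_dotProduct_ne_one hψ ht
  exact AddChar.sum_eq_zero_of_ne_one (ψ := dotChar ψ t) (AddChar.ne_one_iff.2 ⟨y, hy⟩)

lemma exists_eq_sum_addChar_dotProduct (hψ : ψ ≠ 1) (f : (ι → F) → ℂ) :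
    ∃ c : (ι → F) → ℂ, ∀ y, f y = ∑ t, c t * ψ (t ⬝ᵥ y) := by
  have hli : LinearIndependent ℂ fun t : ι → F => ⇑(dotChar ψ t) :=
    (AddChar.linearIndependent (ι → F) ℂ).comp _ (dotChar_injective hψ)
  have hspan := hli.span_eq_top_of_card_eq_finrank' (Module.finrank_fintype_fun_eq_card ℂ).symm
  obtain ⟨c, rfl⟩ := (Submodule.mem_span_range_iff_exists_fun ℂ).1
    (hspan ▸ Submodule.mem_top : f ∈ Submodule.span ℂ _)
  exact ⟨c, fun y => by simp [dotChar_apply]⟩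

end Characters

section ExtendByZero

variable {ι A : Type*} {S : Finset ι}

/-- The vector of `A^ι` that agrees with `s` on `S` and vanishes elsewhere. -/
noncomputable def extendByZero [Zero A] (s : S → A) : ι → A := Function.extend Subtype.val s 0

lemma extendByZero_coe [Zero A] (s : S → A) (i : S) : extendByZero s i = s i :=
  Subtype.val_injective.extend_apply s (0 : ι → A) i

lemma extendByZero_of_notMem [Zero A] (s : S → A) {i : ι} (hi : i ∉ S) : extendByZero s i = 0 :=
  Function.extend_apply' s (0 : ι → A) i fun ⟨j, hj⟩ => hi (hj ▸ j.2)

lemma extendByZero_injective [Zero A] :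
    Function.Injective (extendByZero : (S → A) → ι → A) :=
  Function.extend_injective Subtype.val_injective (0 : ι → A)

lemma extendByZero_dotProduct [Fintype ι] [NonUnitalNonAssocSemiring A] (t : S → A) (x : ι → A) :
    extendByZero t ⬝ᵥ x = t ⬝ᵥ S.restrict x :=
  (Fintype.sum_of_injective _ Subtype.val_injective _ _
    (fun i hi => by rw [extendByZero_of_notMem t fun h => hi ⟨⟨i, h⟩, rfl⟩, zero_mul])
    fun i => by rw [extendByZero_coe]; rfl).symm

end ExtendByZero

section Coordinates

variable {F K : Type*} [Field F] [Field K] [Algebra F K] {n : ℕ} (b : Module.Basis (Fin 2) F K)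

/-- The vector `s ∈ Fⁿ` of a word `b 0 • s + b 1 • t` of `Kⁿ`: it indexes the factor `X(s)` of a
Weyl operator. -/
noncomputable def shiftPart : (Fin n → K) →ₗ[F] Fin n → F := (b.coord 0).compLeft (Fin n)

/-- The vector `t ∈ Fⁿ` of a word `b 0 • s + b 1 • t` of `Kⁿ`: it indexes the factor `Z(t)` of a
Weyl operator. -/
noncomputable def phasePart : (Fin n → K) →ₗ[F] Fin n → F := (b.coord 1).compLeft (Fin n)

lemma apply_eq_zero_iff_shiftPart_phasePart {w : Fin n → K} {i : Fin n} :
    w i = 0 ↔ shiftPart b w i = 0 ∧ phasePart b w i = 0 := by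
  rw [← b.repr.map_eq_zero_iff, Finsupp.ext_iff, Fin.forall_fin_two]
  rfl

lemma eq_zero_of_shiftPart_phasePart {w : Fin n → K} (hs : shiftPart b w = 0)
    (ht : phasePart b w = 0) : w = 0 :=
  funext fun i => (apply_eq_zero_iff_shiftPart_phasePart b).2 ⟨congrFun hs i, congrFun ht i⟩

lemma exists_shiftPart_phasePart (s t : Fin n → F) :
    ∃ w : Fin n → K, shiftPart b w = s ∧ phasePart b w = t :=
  ⟨fun i => s i • b 0 + t i • b 1, by ext; simp [shiftPart], by ext; simp [phasePart]⟩

/-- The symplectic form on `Kⁿ ≃ F²ⁿ` that describes the commutation of Weyl operators. -/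
noncomputable def symplForm (w w' : Fin n → K) : F :=
  shiftPart b w ⬝ᵥ phasePart b w' - phasePart b w ⬝ᵥ shiftPart b w'

lemma symplForm_smul_left (a : F) (w w' : Fin n → K) :
    symplForm b (a • w) w' = a * symplForm b w w' := by
  simp only [symplForm, map_smul, smul_dotProduct, smul_eq_mul, mul_sub]

variable (ψ : AddChar F ℂ) [DecidableEq F]

/-- The matrix of a Weyl operator. -/
noncomputable def weylMatrix (w : Fin n → K) : QuditOp F n :=
  fun x y => if y = x - shiftPart b w then ψ (phasePart b w ⬝ᵥ x) else 0

lemma actsOn_weylMatrix {w : Fin n → K} {S : Finset (Fin n)} (hw : ∀ i ∉ S, w i = 0) :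
    (weylMatrix b ψ w).ActsOn S := by
  have hshift : ∀ i ∉ S, shiftPart b w i = 0 := fun i hi =>
    ((apply_eq_zero_iff_shiftPart_phasePart b).1 (hw i hi)).1
  have hphase : ∀ i ∉ S, phasePart b w i = 0 := fun i hi =>
    ((apply_eq_zero_iff_shiftPart_phasePart b).1 (hw i hi)).2
  refine ⟨fun x y => if ∀ i : S, y i = x i - shiftPart b w i
    then ψ (∑ i : S, phasePart b w i * x i) else 0, fun x y hxy => ?_, fun x y hxy => ?_⟩
  · have hdot : phasePart b w ⬝ᵥ x = ∑ i : S, phasePart b w i * x i := by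
      rw [Finset.sum_coe_sort S fun i => phasePart b w i * x i]
      exact (Finset.sum_subset S.subset_univ fun i _ hi => by rw [hphase i hi, zero_mul]).symm
    have hiff : y = x - shiftPart b w ↔ ∀ i : S, y i = x i - shiftPart b w i := by
      refine ⟨fun h i => congrFun h i, fun h => funext fun i => ?_⟩
      by_cases hi : i ∈ S
      · exact h ⟨i, hi⟩
      · rw [Pi.sub_apply, hshift i hi, sub_zero, hxy i hi]
    simp only [weylMatrix, hdot, hiff]
  · refine if_neg fun h => hxy fun i hi => ?_
    rw [h, Pi.sub_apply, hshift i hi, sub_zero]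

end Coordinates

section Weyl

variable {F K : Type*} [Field F] [Fintype F] [Field K] [Algebra F K] {n : ℕ}
  (b : Module.Basis (Fin 2) F K) (ψ : AddChar F ℂ)

/-- The Weyl operator `weylOp` as a linear map. -/
noncomputable def weyl (w : Fin n → K) : Module.End ℂ (QuditSpace F n) where
  toFun := weylOp b ψ w
  map_add' φ φ' := by ext; simp [weylOp, mul_add]
  map_smul' c φ := by ext; simp [weylOp, mul_left_comm]

lemma weyl_apply (w : Fin n → K) (φ : QuditSpace F n) (x : Fin n → F) :
    weyl b ψ w φ x = ψ (phasePart b w ⬝ᵥ x) * φ (x - shiftPart b w) := rfl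

lemma weyl_zero : weyl b ψ (0 : Fin n → K) = 1 := by
  ext φ x
  simp [weyl_apply]

lemma weyl_mul (w w' : Fin n → K) :
    weyl b ψ w * weyl b ψ w' = ψ (-(phasePart b w' ⬝ᵥ shiftPart b w)) • weyl b ψ (w + w') := by
  ext φ x
  simp only [Module.End.mul_apply, LinearMap.smul_apply, PiLp.smul_apply, smul_eq_mul, weyl_apply,
    ← mul_assoc, ← AddChar.map_add_eq_mul, map_add, dotProduct_sub, add_dotProduct, sub_sub]
  congr 2
  ring

lemma weyl_mul_comm (w w' : Fin n → K) :
    weyl b ψ w * weyl b ψ w' = ψ (-symplForm b w w') • (weyl b ψ w' * weyl b ψ w) := by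
  rw [weyl_mul, weyl_mul, smul_smul, add_comm w', ← AddChar.map_add_eq_mul, symplForm,
    dotProduct_comm (phasePart b w')]
  congr 2
  ring

lemma inner_weyl_weyl (w : Fin n → K) (u v : QuditSpace F n) :
    inner ℂ (weyl b ψ w u) (weyl b ψ w v) = inner ℂ u v := by
  simp only [PiLp.inner_apply]
  rw [← Equiv.sum_comp (Equiv.subRight (shiftPart b w)) fun x => inner ℂ (u x) (v x)]
  refine Finset.sum_congr rfl fun x _ => ?_
  rw [weyl_apply, weyl_apply, ← smul_eq_mul, ← smul_eq_mul, inner_smul_left, inner_smul_right,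
    ← mul_assoc, ← AddChar.map_neg_eq_conj, ← AddChar.map_add_eq_mul, neg_add_cancel,
    AddChar.map_zero_eq_one, one_mul, Equiv.subRight_apply]

lemma weyl_injective (w : Fin n → K) : Function.Injective (weyl b ψ w) :=
  (injective_iff_map_eq_zero _).2 fun u hu => by
    rw [← inner_self_eq_zero (𝕜 := ℂ), ← inner_weyl_weyl b ψ w, hu, inner_zero_left]

lemma toEuclideanLin_weylMatrix [DecidableEq F] (w : Fin n → K) :
    Matrix.toEuclideanLin (weylMatrix b ψ w) = weyl b ψ w := by
  ext φ x
  simp [Matrix.toLpLin_apply, Matrix.mulVec, dotProduct, weylMatrix, weyl_apply]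

lemma trace_weyl [DecidableEq F] (w : Fin n → K) :
    LinearMap.trace ℂ _ (weyl b ψ w) =
      if shiftPart b w = 0 then ∑ x, ψ (phasePart b w ⬝ᵥ x) else 0 := by
  rw [← toEuclideanLin_weylMatrix, Matrix.toEuclideanLin, Matrix.toLpLin_eq_toLin,
    Matrix.trace_toLin_eq, Matrix.trace]
  simp [weylMatrix, eq_sub_iff_add_eq]

variable {ψ}

lemma trace_weyl_of_ne_zero (hψ : ψ ≠ 1) {w : Fin n → K} (hw : w ≠ 0) :
    LinearMap.trace ℂ _ (weyl b ψ w) = 0 := by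
  classical
  rw [trace_weyl]
  split_ifs with hs
  · exact sum_addChar_dotProduct hψ fun ht => hw (eq_zero_of_shiftPart_phasePart b hs ht)
  · rfl

lemma trace_weyl_zero :
    LinearMap.trace ℂ _ (weyl b ψ (0 : Fin n → K)) = (Fintype.card F : ℂ) ^ n := by
  rw [weyl_zero, LinearMap.trace_one, finrank_euclideanSpace]
  simp

/-- Only the entries of `E` in the columns `x - s`, with `s` supported on `S`, contribute to its
row `x`. -/
lemma QuditOp.ActsOn.exists_toEuclideanLin_apply {A : Type*} [AddCommGroup A] [Fintype A]
    [DecidableEq A] {E : QuditOp A n} {S : Finset (Fin n)} (hE : E.ActsOn S) :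
    ∃ M : Matrix (S → A) (S → A) ℂ, ∀ φ x, Matrix.toEuclideanLin E φ x =
      ∑ s : S → A, M (S.restrict x) (S.restrict x - s) * φ (x - extendByZero s) := by
  obtain ⟨M, hM, hM0⟩ := hE
  refine ⟨M, fun φ x => ?_⟩
  have entry_of_notMem_range : ∀ y ∉ Set.range fun s : S → A => x - extendByZero s,
      E x y = 0 := by
    refine fun y hy => hM0 x y fun h => hy ⟨S.restrict (x - y), funext fun i => ?_⟩
    by_cases hi : i ∈ S
    · simp [extendByZero_coe _ ⟨i, hi⟩]
    · simp [extendByZero_of_notMem _ hi, h i hi]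
  have entry_sub (s : S → A) :
      E x (x - extendByZero s) = M (S.restrict x) (S.restrict x - s) := by
    rw [hM x _ fun i hi => by simp [extendByZero_of_notMem s hi]]
    congr 1
    ext i
    simp [extendByZero_coe]
  calc Matrix.toEuclideanLin E φ x = ∑ y, E x y * φ y := rfl
    _ = _ := (Fintype.sum_of_injective (fun s : S → A => x - extendByZero s)
      (sub_right_injective.comp extendByZero_injective) _ _
      (fun y hy => by rw [entry_of_notMem_range y hy, zero_mul])
      fun s => by rw [entry_sub]).symm

/-- The Weyl operators that are supported on `S` span the operators that act on `S`: expand the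
entries of such an operator along each translate of the diagonal into characters. -/
lemma QuditOp.ActsOn.toEuclideanLin_mem_span_weyl [DecidableEq F] (hψ : ψ ≠ 1) {E : QuditOp F n}
    {S : Finset (Fin n)} (hE : E.ActsOn S) :
    Matrix.toEuclideanLin E ∈ Submodule.span ℂ (weyl b ψ '' {w | ∀ i ∉ S, w i = 0}) := by
  obtain ⟨M, hM⟩ := hE.exists_toEuclideanLin_apply
  choose c hc using fun s : S → F => exists_eq_sum_addChar_dotProduct hψ fun y => M y (y - s)
  choose w hshift hphase using fun s t : S → F =>
    exists_shiftPart_phasePart b (extendByZero s) (extendByZero t)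
  have hE_eq : Matrix.toEuclideanLin E = ∑ s, ∑ t, c s t • weyl b ψ (w s t) := by
    ext φ x
    simp only [hM, hc, LinearMap.sum_apply, LinearMap.smul_apply, WithLp.ofLp_sum,
      Finset.sum_apply, PiLp.smul_apply, smul_eq_mul, weyl_apply, hshift, hphase,
      extendByZero_dotProduct, Finset.sum_mul, mul_assoc]
  rw [hE_eq]
  refine sum_mem fun s _ => sum_mem fun t _ => Submodule.smul_mem _ _ (Submodule.subset_span
    ⟨w s t, fun i hi => (apply_eq_zero_iff_shiftPart_phasePart b).2 ?_, rfl⟩)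
  rw [hshift, hphase]
  exact ⟨extendByZero_of_notMem s hi, extendByZero_of_notMem t hi⟩

end Weyl

/-! ### Stabilizer codes -/

section Detectable

variable {H : Type*} [NormedAddCommGroup H] [InnerProductSpace ℂ H]

/-- The operators that satisfy the Knill–Laflamme condition for `Q`. -/
def detectable (Q : Submodule ℂ H) : Submodule ℂ (Module.End ℂ H) where
  carrier := {T | ∃ c : ℂ, ∀ u ∈ Q, ∀ v ∈ Q, inner ℂ u (T v) = c * inner ℂ u v}
  zero_mem' := ⟨0, fun u _ v _ => by simp⟩
  add_mem' := fun ⟨c, hc⟩ ⟨d, hd⟩ => ⟨c + d, fun u hu v hv => by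
    rw [LinearMap.add_apply, inner_add_right, hc u hu v hv, hd u hu v hv, add_mul]⟩
  smul_mem' := fun a _ ⟨c, hc⟩ => ⟨a * c, fun u hu v hv => by
    rw [LinearMap.smul_apply, inner_smul_right, hc u hu v hv, mul_assoc]⟩

lemma detects_iff_mem_detectable {A : Type*} [Fintype A] [DecidableEq A] {n : ℕ}
    {Q : Submodule ℂ (QuditSpace A n)} {E : QuditOp A n} :
    Detects Q E ↔ Matrix.toEuclideanLin E ∈ detectable Q := Iff.rfl

lemma exists_eq_smul_of_mem_detectable {Q : Submodule ℂ H} {T : Module.End ℂ H}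
    (hT : T ∈ detectable Q) (hQ : ∀ v ∈ Q, T v ∈ Q) : ∃ c : ℂ, ∀ v ∈ Q, T v = c • v := by
  obtain ⟨c, hc⟩ := hT
  refine ⟨c, fun v hv => sub_eq_zero.1 ((inner_self_eq_zero (𝕜 := ℂ)).1 ?_)⟩
  rw [inner_sub_right, inner_smul_right,
    hc _ (sub_mem (hQ v hv) (Submodule.smul_mem Q c hv)) v hv, sub_self]

end Detectable

section Stabilizer

variable {F K : Type*} [Field F] [Field K] [Algebra F K] {n : ℕ}

/-- The symplectic form vanishes on `C`. -/
def IsIsotropic (b : Module.Basis (Fin 2) F K) (C : Submodule F (Fin n → K)) : Prop :=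
  ∀ w ∈ C, ∀ w' ∈ C, symplForm b w w' = 0

lemma symplForm_eq_zero_of_addChar_eq_one {b : Module.Basis (Fin 2) F K} {ψ : AddChar F ℂ}
    (hψ : ψ ≠ 1) {C : Submodule F (Fin n → K)} {w : Fin n → K}
    (hw : ∀ c ∈ C, ψ (-symplForm b c w) = 1) : ∀ c ∈ C, symplForm b c w = 0 := by
  by_contra! ⟨c, hc, hne⟩
  obtain ⟨a, ha⟩ := AddChar.ne_one_iff.1 (AddChar.IsPrimitive.of_ne_one hψ hne)
  have := hw (-a • c) (C.smul_mem _ hc)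
  rw [symplForm_smul_left, neg_mul, neg_neg, mul_comm] at this
  exact ha this

variable [Fintype F] (b : Module.Basis (Fin 2) F K) (ψ : AddChar F ℂ)

/-- The Weyl operator of `w`, with the phase for which the operators of the words of an isotropic
code multiply like these words add. -/
noncomputable def normalizedWeyl (w : Fin n → K) : Module.End ℂ (QuditSpace F n) :=
  ψ (-(2⁻¹ * phasePart b w ⬝ᵥ shiftPart b w)) • weyl b ψ w

lemma normalizedWeyl_zero : normalizedWeyl b ψ (0 : Fin n → K) = 1 := by
  simp [normalizedWeyl, weyl_zero]

lemma normalizedWeyl_mul [NeZero (2 : F)] {w w' : Fin n → K} (h : symplForm b w w' = 0) :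
    normalizedWeyl b ψ w * normalizedWeyl b ψ w' = normalizedWeyl b ψ (w + w') := by
  simp only [normalizedWeyl, smul_mul_smul_comm, weyl_mul, smul_smul, ← AddChar.map_add_eq_mul]
  congr 2
  rw [symplForm, dotProduct_comm] at h
  simp only [map_add, add_dotProduct, dotProduct_add]
  have h2 : (2 : F) ≠ 0 := two_ne_zero
  field_simp
  linear_combination -h

lemma normalizedWeyl_mul_weyl (c w : Fin n → K) :
    normalizedWeyl b ψ c * weyl b ψ w =
      ψ (-symplForm b c w) • (weyl b ψ w * normalizedWeyl b ψ c) := by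
  rw [normalizedWeyl, smul_mul_assoc, mul_smul_comm, weyl_mul_comm, smul_comm]

lemma normalizedWeyl_apply_eq_self_iff {w : Fin n → K} {φ : QuditSpace F n} :
    normalizedWeyl b ψ w φ = φ ↔
      weyl b ψ w φ = ψ (2⁻¹ * phasePart b w ⬝ᵥ shiftPart b w) • φ := by
  rw [normalizedWeyl, LinearMap.smul_apply, AddChar.map_neg_eq_inv,
    inv_smul_eq_iff₀ (AddChar.val_isUnit _ _).ne_zero]

lemma inner_normalizedWeyl_normalizedWeyl (w : Fin n → K) (u v : QuditSpace F n) :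
    inner ℂ (normalizedWeyl b ψ w u) (normalizedWeyl b ψ w v) = inner ℂ u v := by
  rw [normalizedWeyl, LinearMap.smul_apply, LinearMap.smul_apply, inner_smul_left,
    inner_smul_right, inner_weyl_weyl, ← mul_assoc, ← AddChar.map_neg_eq_conj,
    ← AddChar.map_add_eq_mul, neg_add_cancel, AddChar.map_zero_eq_one, one_mul]

/-- The stabilizer code of an isotropic code `C`: the vectors fixed by the normalized Weyl operators
of the words of `C`. -/
noncomputable def stabilizerCode (C : Submodule F (Fin n → K)) :
    Submodule ℂ (QuditSpace F n) where
  carrier := {φ | ∀ w ∈ C, normalizedWeyl b ψ w φ = φ}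
  zero_mem' := fun _ _ => map_zero _
  add_mem' := fun hu hv w hw => by rw [map_add, hu w hw, hv w hw]
  smul_mem' := fun c _ hu w hw => by rw [map_smul, hu w hw]

/-- The average of the normalized Weyl operators of the words of `C`: the projection onto the
stabilizer code when `C` is isotropic. -/
noncomputable def stabilizerProj (C : Submodule F (Fin n → K)) [Fintype C] :
    Module.End ℂ (QuditSpace F n) :=
  (Fintype.card C : ℂ)⁻¹ • ∑ w : C, normalizedWeyl b ψ w

variable {b ψ} {C : Submodule F (Fin n → K)}

lemma normalizedWeyl_mul_stabilizerProj [NeZero (2 : F)] [Fintype C] (hC : IsIsotropic b C)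
    {w : Fin n → K} (hw : w ∈ C) :
    normalizedWeyl b ψ w * stabilizerProj b ψ C = stabilizerProj b ψ C := by
  rw [stabilizerProj, mul_smul_comm, Finset.mul_sum,
    ← Equiv.sum_comp (Equiv.addLeft (⟨w, hw⟩ : C)) fun c => normalizedWeyl b ψ c.1]
  exact congrArg _ (Finset.sum_congr rfl fun c _ => normalizedWeyl_mul b ψ (hC w hw c c.2))

lemma isProj_stabilizerProj [NeZero (2 : F)] [Fintype C] (hC : IsIsotropic b C) :
    LinearMap.IsProj (stabilizerCode b ψ C) (stabilizerProj b ψ C) where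
  map_mem φ w hw := LinearMap.congr_fun (normalizedWeyl_mul_stabilizerProj hC hw) φ
  map_id φ hφ := by
    rw [stabilizerProj, LinearMap.smul_apply, LinearMap.sum_apply,
      Finset.sum_congr rfl fun (w : C) _ => hφ w w.2, Finset.sum_const, Finset.card_univ,
      ← Nat.cast_smul_eq_nsmul ℂ, inv_smul_smul₀ (Nat.cast_ne_zero.2 Fintype.card_ne_zero)]

lemma trace_mul_stabilizerProj [Fintype C] (T : Module.End ℂ (QuditSpace F n)) :
    LinearMap.trace ℂ _ (T * stabilizerProj b ψ C) =
      (Fintype.card C : ℂ)⁻¹ * ∑ w : C, LinearMap.trace ℂ _ (T * normalizedWeyl b ψ w) := by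
  rw [stabilizerProj, mul_smul_comm, map_smul, Finset.mul_sum, map_sum, smul_eq_mul]

lemma finrank_stabilizerCode_mul_card [NeZero (2 : F)] (hψ : ψ ≠ 1) [Finite C]
    (hC : IsIsotropic b C) :
    Module.finrank ℂ (stabilizerCode b ψ C) * Nat.card C = Fintype.card F ^ n := by
  have := Fintype.ofFinite C
  have htrace : (Module.finrank ℂ (stabilizerCode b ψ C) : ℂ) =
      (Fintype.card C : ℂ)⁻¹ * (Fintype.card F : ℂ) ^ n := by
    rw [← (isProj_stabilizerProj hC).trace, ← one_mul (stabilizerProj b ψ C),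
      trace_mul_stabilizerProj, Finset.sum_eq_single 0 (fun w _ hw => ?_) (by simp)]
    · rw [one_mul, ZeroMemClass.coe_zero, normalizedWeyl_zero, ← weyl_zero b ψ, trace_weyl_zero]
    · rw [one_mul, normalizedWeyl, map_smul, trace_weyl_of_ne_zero b hψ (by simpa using hw),
        smul_zero]
  have hcard : (Fintype.card C : ℂ) ≠ 0 := Nat.cast_ne_zero.2 Fintype.card_ne_zero
  rw [eq_inv_mul_iff_mul_eq₀ hcard, mul_comm] at htrace
  rw [Nat.card_eq_fintype_card]
  exact_mod_cast htrace

lemma stabilizerCode_ne_bot [NeZero (2 : F)] (hψ : ψ ≠ 1) [Finite C] (hC : IsIsotropic b C) :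
    stabilizerCode b ψ C ≠ ⊥ := by
  intro hbot
  have hcard := finrank_stabilizerCode_mul_card hψ hC
  rw [hbot, finrank_bot, zero_mul] at hcard
  exact pow_ne_zero n Fintype.card_ne_zero hcard.symm

lemma weyl_mem_detectable_of_mem {w : Fin n → K} (hw : w ∈ C) :
    weyl b ψ w ∈ detectable (stabilizerCode b ψ C) :=
  ⟨ψ (2⁻¹ * phasePart b w ⬝ᵥ shiftPart b w), fun u _ v hv => by
    rw [(normalizedWeyl_apply_eq_self_iff b ψ).1 (hv w hw), inner_smul_right]⟩

/-- A Weyl operator that does not commute with the stabilizer maps the code to its orthogonal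
complement. -/
lemma weyl_mem_detectable_of_addChar_ne_one {c w : Fin n → K} (hc : c ∈ C)
    (hcw : ψ (-symplForm b c w) ≠ 1) : weyl b ψ w ∈ detectable (stabilizerCode b ψ C) := by
  refine ⟨0, fun u hu v hv => ?_⟩
  have hcomm : normalizedWeyl b ψ c (weyl b ψ w v) = ψ (-symplForm b c w) • weyl b ψ w v := by
    have := LinearMap.congr_fun (normalizedWeyl_mul_weyl b ψ c w) v
    rwa [Module.End.mul_apply, LinearMap.smul_apply, Module.End.mul_apply, hv c hc] at this
  have hinner := inner_normalizedWeyl_normalizedWeyl b ψ c u (weyl b ψ w v)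
  rw [hu c hc, hcomm, inner_smul_right, mul_left_eq_self₀] at hinner
  rw [hinner.resolve_left hcw, zero_mul]

lemma weyl_mem_stabilizerCode {w : Fin n → K} (hw : ∀ c ∈ C, symplForm b c w = 0)
    {v : QuditSpace F n} (hv : v ∈ stabilizerCode b ψ C) :
    weyl b ψ w v ∈ stabilizerCode b ψ C := by
  intro c hc
  have := LinearMap.congr_fun (normalizedWeyl_mul_weyl b ψ c w) v
  rwa [hw c hc, neg_zero, AddChar.map_zero_eq_one, one_smul, Module.End.mul_apply,
    Module.End.mul_apply, hv c hc] at this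

lemma trace_weyl_mul_stabilizerProj (hψ : ψ ≠ 1) [Fintype C] {w : Fin n → K} (hw : w ∉ C) :
    LinearMap.trace ℂ _ (weyl b ψ w * stabilizerProj b ψ C) = 0 := by
  rw [trace_mul_stabilizerProj, Finset.sum_eq_zero, mul_zero]
  intro c _
  have hne : w + c ≠ 0 := fun h => hw (eq_neg_of_add_eq_zero_left h ▸ C.neg_mem c.2)
  rw [normalizedWeyl, mul_smul_comm, weyl_mul, map_smul, map_smul, trace_weyl_of_ne_zero b hψ hne,
    smul_zero, smul_zero]

/-- A Weyl operator that commutes with the stabilizer without belonging to it preserves the code but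
has trace zero on it, hence cannot be a scalar there. -/
lemma weyl_notMem_detectable [NeZero (2 : F)] (hψ : ψ ≠ 1) [Finite C] (hC : IsIsotropic b C)
    {w : Fin n → K} (hw : ∀ c ∈ C, symplForm b c w = 0) (hwC : w ∉ C) :
    weyl b ψ w ∉ detectable (stabilizerCode b ψ C) := by
  have := Fintype.ofFinite C
  intro hdet
  obtain ⟨z, hz⟩ :=
    exists_eq_smul_of_mem_detectable hdet fun v hv => weyl_mem_stabilizerCode hw hv
  have hproj := isProj_stabilizerProj (ψ := ψ) hC
  have hmul : weyl b ψ w * stabilizerProj b ψ C = z • stabilizerProj b ψ C :=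
    LinearMap.ext fun v => hz _ (hproj.map_mem v)
  have htrace := trace_weyl_mul_stabilizerProj (b := b) hψ hwC
  rw [hmul, map_smul, hproj.trace, smul_eq_mul, mul_eq_zero, Nat.cast_eq_zero,
    Submodule.finrank_eq_zero] at htrace
  have hz0 : z = 0 := htrace.resolve_right (stabilizerCode_ne_bot hψ hC)
  refine stabilizerCode_ne_bot hψ hC ((Submodule.eq_bot_iff _).2 fun v hv => ?_)
  exact weyl_injective b ψ w (by rw [hz v hv, hz0, zero_smul, map_zero])

theorem hasMinDistance_stabilizerCode [NeZero (2 : F)] (hψ : ψ ≠ 1) [Finite C]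
    (hC : IsIsotropic b C) [DecidableEq K] {d : ℕ}
    (hd : IsLeast (hammingNorm '' {w | (∀ c ∈ C, symplForm b c w = 0) ∧ w ∉ C}) d) :
    HasMinDistance (stabilizerCode b ψ C) d := by
  classical
  refine ⟨?_, ?_⟩
  · obtain ⟨w, ⟨hw, hwC⟩, rfl⟩ := hd.1
    refine ⟨Finset.univ.filter fun i => w i ≠ 0, weylMatrix b ψ w, rfl,
      actsOn_weylMatrix b ψ (by simp), ?_⟩
    rw [detects_iff_mem_detectable, toEuclideanLin_weylMatrix]
    exact weyl_notMem_detectable hψ hC hw hwC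
  · rintro _ ⟨S, E, rfl, hE, hnd⟩
    by_contra! hlt
    refine hnd (detects_iff_mem_detectable.2 (Submodule.span_le.2 ?_
      (hE.toEuclideanLin_mem_span_weyl b hψ)))
    rintro _ ⟨w, hwS, rfl⟩
    have hnorm : hammingNorm w < d := lt_of_le_of_lt
      (Finset.card_le_card fun i hi => by_contra fun h => (Finset.mem_filter.1 hi).2 (hwS i h)) hlt
    by_cases hwC : w ∈ C
    · exact weyl_mem_detectable_of_mem hwC
    · obtain ⟨c, hc, hne⟩ : ∃ c ∈ C, ψ (-symplForm b c w) ≠ 1 := by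
        by_contra! h
        exact hnorm.not_ge
          (hd.2 ⟨w, ⟨symplForm_eq_zero_of_addChar_eq_one hψ h, hwC⟩, rfl⟩)
      exact weyl_mem_detectable_of_addChar_ne_one hc hne

end Stabilizer

/-! ### Codes from the Hermitian construction -/

section HermitianDual

open FiniteField (frobeniusAlgHom frobeniusAlgHom_apply)

variable {F K : Type*} [Field F] [Fintype F] [Field K] [Algebra F K] {n : ℕ}

local notation "q" => Fintype.card F

lemma natCard_eq_card_sq (b : Module.Basis (Fin 2) F K) : Nat.card K = q ^ 2 := by
  have := Module.Finite.of_basis b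
  rw [Module.natCard_eq_pow_finrank (K := F), Module.finrank_eq_card_basis b, Fintype.card_fin,
    Nat.card_eq_fintype_card]

lemma exists_pow_card_ne (b : Module.Basis (Fin 2) F K) : ∃ x : K, x ^ q ≠ x := by
  have := Module.Finite.of_basis b
  have := Module.finite_of_finite F (M := K)
  have := Fintype.ofFinite K
  by_contra! h
  have hdvd : q ^ 2 - 1 ∣ q - 1 := by
    rw [← natCard_eq_card_sq b, Nat.card_eq_fintype_card, ← FiniteField.forall_pow_eq_one_iff K]
    refine fun x => Units.ext (mul_right_cancel₀ x.ne_zero ?_)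
    rw [Units.val_pow_eq_pow_val, ← pow_succ, Nat.sub_add_cancel Fintype.card_pos, h, Units.val_one,
      one_mul]
  have hq : 1 < q := Fintype.one_lt_card
  have hle := Nat.le_of_dvd (Nat.sub_pos_of_lt hq) hdvd
  have : q < q ^ 2 := by nlinarith
  omega

lemma algebraMap_coord_det (b : Module.Basis (Fin 2) F K) (x y : K) :
    algebraMap F K (b.coord 0 x * b.coord 1 y - b.coord 1 x * b.coord 0 y) *
        (b 0 * b 1 ^ q - b 1 * b 0 ^ q) = x * y ^ q - y * x ^ q := by
  have hsum : ∀ z : K, z =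
      algebraMap F K (b.coord 0 z) * b 0 + algebraMap F K (b.coord 1 z) * b 1 := fun z => by
    simpa [Fin.sum_univ_two, Algebra.smul_def] using (b.sum_repr z).symm
  have hfrob : ∀ z : K, z ^ q =
      algebraMap F K (b.coord 0 z) * b 0 ^ q + algebraMap F K (b.coord 1 z) * b 1 ^ q := fun z => by
    conv_lhs => rw [hsum z]
    simp only [← frobeniusAlgHom_apply F K, map_add, map_mul, AlgHom.commutes]
  rw [hfrob x, hfrob y]
  conv_rhs => rw [hsum x, hsum y]
  simp only [map_sub, map_mul, map_add, ← Algebra.smul_def, map_smul, Module.Basis.coord_apply,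
    Module.Basis.repr_self]
  simp [Algebra.smul_def]
  ring

lemma det_conj_ne_zero (b : Module.Basis (Fin 2) F K) : b 0 * b 1 ^ q - b 1 * b 0 ^ q ≠ 0 := by
  intro h
  obtain ⟨x, hx⟩ := exists_pow_card_ne b
  have := algebraMap_coord_det b x 1
  rw [h, mul_zero, one_pow, mul_one, one_mul] at this
  exact hx (sub_eq_zero.1 this.symm).symm

lemma symplForm_eq_zero_iff (b : Module.Basis (Fin 2) F K) (w w' : Fin n → K) :
    symplForm b w w' = 0 ↔ hermInner q w w' = hermInner q w' w := by
  have hmul : algebraMap F K (symplForm b w w') * (b 0 * b 1 ^ q - b 1 * b 0 ^ q) =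
      hermInner q w w' - hermInner q w' w := by
    rw [hermInner, hermInner, ← Finset.sum_sub_distrib, symplForm, dotProduct, dotProduct,
      ← Finset.sum_sub_distrib, map_sum, Finset.sum_mul]
    exact Finset.sum_congr rfl fun i _ => algebraMap_coord_det b (w i) (w' i)
  rw [← sub_eq_zero (a := hermInner _ _ _), ← hmul, mul_eq_zero, map_eq_zero,
    or_iff_left (det_conj_ne_zero b)]

lemma hermInner_smul_left (m : ℕ) (c : K) (w w' : Fin n → K) :
    hermInner m (c • w) w' = c * hermInner m w w' := by
  simp only [hermInner, Finset.mul_sum, Pi.smul_apply, smul_eq_mul, mul_assoc]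

lemma hermInner_smul_right (m : ℕ) (c : K) (w w' : Fin n → K) :
    hermInner m w (c • w') = c ^ m * hermInner m w w' := by
  simp only [hermInner, Finset.mul_sum, Pi.smul_apply, smul_eq_mul, mul_pow, mul_left_comm]

lemma hermInner_swap (b : Module.Basis (Fin 2) F K) (w w' : Fin n → K) :
    hermInner q w' w = hermInner q w w' ^ q := by
  have := Module.Finite.of_basis b
  have := Module.finite_of_finite F (M := K)
  have := Fintype.ofFinite K
  simp only [hermInner, ← frobeniusAlgHom_apply F K, map_sum, map_mul]
  refine Finset.sum_congr rfl fun i _ => ?_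
  simp only [frobeniusAlgHom_apply, ← pow_mul]
  rw [← sq, ← natCard_eq_card_sq b, Nat.card_eq_fintype_card, FiniteField.pow_card, mul_comm]

/-- For a `K`-linear code the Hermitian and the symplectic dual agree: a multiple `a • c` with
`a ^ q ≠ a` separates the two sides of the criterion `symplForm_eq_zero_iff`. -/
lemma mem_hermDual_iff_symplForm (b : Module.Basis (Fin 2) F K) {C : Submodule K (Fin n → K)}
    {w : Fin n → K} : w ∈ hermDual q C ↔ ∀ c ∈ C, symplForm b c w = 0 := by
  refine ⟨fun hw c hc => ?_, fun hw c hc => ?_⟩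
  · rw [symplForm_eq_zero_iff, hermInner_swap b w, hw c hc, zero_pow Fintype.card_ne_zero]
  · obtain ⟨a, ha⟩ := exists_pow_card_ne b
    have heq := (symplForm_eq_zero_iff b _ _).1 (hw c hc)
    have hsmul := (symplForm_eq_zero_iff b _ _).1 (hw (a • c) (C.smul_mem a hc))
    rw [hermInner_smul_left, hermInner_smul_right, heq, ← sub_eq_zero, ← sub_mul] at hsmul
    exact (mul_eq_zero.1 hsmul).resolve_left (sub_ne_zero.2 ha.symm)

lemma isIsotropic_restrictScalars (b : Module.Basis (Fin 2) F K) {C : Submodule K (Fin n → K)}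
    (hC : IsHermSelfOrthogonal q C) : IsIsotropic b (C.restrictScalars F) :=
  fun w hw _ hw' => (mem_hermDual_iff_symplForm b).1 (hC hw') w hw

lemma isHermitianConstruction_stabilizerCode [NeZero (2 : F)] {b : Module.Basis (Fin 2) F K}
    {ψ : AddChar F ℂ} (hψ : ψ ≠ 1) {C : Submodule K (Fin n → K)}
    (hC : IsHermSelfOrthogonal q C) :
    IsHermitianConstruction C (stabilizerCode b ψ (C.restrictScalars F)) := by
  have := Module.Finite.of_basis b
  have := Module.finite_of_finite F (M := K)
  exact ⟨stabilizerCode_ne_bot hψ (isIsotropic_restrictScalars b hC), b, ψ,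
    fun w => ψ (2⁻¹ * phasePart b w ⬝ᵥ shiftPart b w), hψ,
    fun _ => forall₂_congr fun _ _ => normalizedWeyl_apply_eq_self_iff b ψ⟩

theorem isQuantumCode_stabilizerCode [NeZero (2 : F)] {b : Module.Basis (Fin 2) F K}
    {ψ : AddChar F ℂ} (hψ : ψ ≠ 1) {C : Submodule K (Fin n → K)}
    (hC : IsHermSelfOrthogonal q C) [DecidableEq K] {d : ℕ}
    (hd : IsLeast (hammingNorm '' (hermDual q C \ C)) d) :
    IsQuantumCode (stabilizerCode b ψ (C.restrictScalars F))
      (n - 2 * Module.finrank K C) d := by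
  have := Module.Finite.of_basis b
  have := Module.finite_of_finite F (M := K)
  have hiso := isIsotropic_restrictScalars b hC
  refine ⟨?_, hasMinDistance_stabilizerCode hψ hiso ?_⟩
  · have hcard := finrank_stabilizerCode_mul_card hψ hiso
    have hC' : Nat.card (C.restrictScalars F) = q ^ (2 * Module.finrank K C) := by
      rw [pow_mul, ← natCard_eq_card_sq b]
      exact Module.natCard_eq_pow_finrank (K := K) (V := C)
    rw [hC'] at hcard
    have hq : 1 < q := Fintype.one_lt_card
    rw [← Nat.pow_div ((Nat.pow_dvd_pow_iff_le_right hq).1 ⟨_, (mul_comm _ _).trans hcard |>.symm⟩)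
      (zero_lt_one.trans hq), ← hcard, Nat.mul_div_cancel _ (pow_pos (zero_lt_one.trans hq) _)]
  · convert hd using 2
    ext w
    exact and_congr_left' (mem_hermDual_iff_symplForm b).symm

end HermitianDual

/-! ### Distances of generalized Reed–Solomon codes -/

section GRS

open Polynomial

variable {K : Type*} [Field K] {n k : ℕ} {a v : Fin n → K}

lemma mem_grsCode {x : Fin n → K} :
    x ∈ grsCode k a v ↔ ∃ f : K[X], f.degree < k ∧ ∀ i, x i = v i * f.eval (a i) := by
  simp only [grsCode, Submodule.mem_map, mem_degreeLT]
  refine exists_congr fun f => and_congr_right fun _ => ?_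
  rw [eq_comm, funext_iff]
  rfl

lemma grsCode_eq_span :
    grsCode k a v = Submodule.span K {x | ∃ s < k, x = fun i => v i * a i ^ s} := by
  classical
  rw [grsCode, degreeLT_eq_span_X_pow, Submodule.map_span]
  congr 1
  ext x
  simp [funext_iff, eq_comm]

lemma finrank_grsCode (ha : Function.Injective a) (hv : ∀ i, v i ≠ 0) (hk : k ≤ n) :
    Module.finrank K (grsCode k a v) = k := by
  rw [grsCode, ← LinearMap.range_domRestrict, LinearMap.finrank_range_of_inj,
    (degreeLTEquiv K k).finrank_eq, Module.finrank_fin_fun]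
  refine (injective_iff_map_eq_zero _).2 fun f hf => Subtype.ext ?_
  refine eq_zero_of_degree_lt_of_eval_index_eq_zero Finset.univ ha.injOn
    ((mem_degreeLT.1 f.2).trans_le (by simpa using hk)) fun i _ => ?_
  have hfi : v i * (f : K[X]).eval (a i) = 0 := congrFun hf i
  exact (mul_eq_zero.1 hfi).resolve_left (hv i)

lemma lt_add_hammingNorm_of_mem_grsCode [DecidableEq K] (ha : Function.Injective a)
    (hv : ∀ i, v i ≠ 0) {x : Fin n → K} (hx : x ∈ grsCode k a v) (hx0 : x ≠ 0) :
    n < k + hammingNorm x := by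
  obtain ⟨f, hf, hxf⟩ := mem_grsCode.1 hx
  have hzeros : (Finset.univ.filter fun i => x i = 0).card < k := by
    by_contra! h
    have hf0 : f = 0 := eq_zero_of_degree_lt_of_eval_index_eq_zero _ ha.injOn
      (hf.trans_le (by exact_mod_cast h)) fun i hi => by
        have hfi := (Finset.mem_filter.1 hi).2
        rw [hxf] at hfi
        exact (mul_eq_zero.1 hfi).resolve_left (hv i)
    exact hx0 (funext fun i => by rw [hxf, hf0, eval_zero, mul_zero, Pi.zero_apply])
  calc n = (Finset.univ.filter fun i => x i = 0).card + hammingNorm x := by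
        rw [hammingNorm, Finset.card_filter_add_card_filter_not, Finset.card_univ,
          Fintype.card_fin]
    _ < k + hammingNorm x := Nat.add_lt_add_right hzeros _

lemma lt_hammingNorm_of_mem_hermDual_grsCode [DecidableEq K] (ha : Function.Injective a)
    (hv : ∀ i, v i ≠ 0) {q : ℕ} (hq : q ≠ 0) {w : Fin n → K}
    (hw : w ∈ hermDual q (grsCode k a v)) (hw0 : w ≠ 0) : k < hammingNorm w := by
  by_contra! hle
  obtain ⟨i, hi⟩ := Function.ne_iff.1 hw0
  let S := Finset.univ.filter fun j => w j ≠ 0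
  have hiS : i ∈ S := by simpa [S] using hi
  have hmem : (fun j => v j * (Lagrange.basis S a i).eval (a j)) ∈ grsCode k a v := by
    refine mem_grsCode.2 ⟨_, ?_, fun _ => rfl⟩
    rw [Lagrange.degree_basis ha.injOn hiS]
    exact_mod_cast (Nat.sub_lt (Finset.card_pos.2 ⟨i, hiS⟩) one_pos).trans_le hle
  have hinner := hw _ hmem
  rw [hermInner, Finset.sum_eq_single i (fun j _ hj => ?_) (by simp),
    Lagrange.eval_basis_self ha.injOn hiS, mul_one] at hinner
  · exact mul_ne_zero hi (pow_ne_zero q (hv i)) hinner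
  · by_cases hjS : j ∈ S
    · rw [Lagrange.eval_basis_of_ne hj.symm hjS, mul_zero, zero_pow hq, mul_zero]
    · rw [show w j = 0 by simpa [S] using hjS, zero_mul]

lemma sum_nodalWeight_mul_eval_eq_zero {ι : Type*} [DecidableEq ι] {s : Finset ι} {y : ι → K}
    (hy : Set.InjOn y s) {P : K[X]} (hP : P.degree < (s.card - 1 : ℕ)) :
    ∑ i ∈ s, Lagrange.nodalWeight s y i * P.eval (y i) = 0 := by
  calc ∑ i ∈ s, Lagrange.nodalWeight s y i * P.eval (y i)
      = ∑ i ∈ s, P.eval (y i) / ∏ j ∈ s.erase i, (y i - y j) :=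
        Finset.sum_congr rfl fun i _ => by
          rw [Lagrange.nodalWeight, Finset.prod_inv_distrib, div_eq_inv_mul]
    _ = P.coeff (s.card - 1) :=
        (Lagrange.coeff_eq_sum hy (hP.trans_le (by exact_mod_cast Nat.sub_le _ _))).symm
    _ = 0 := coeff_eq_zero_of_degree_lt hP

variable {F : Type*} [Field F] [Fintype F] [Algebra F K]

lemma exists_mem_hermDual_grsCode (ha : Function.Injective a) (hv : ∀ i, v i ≠ 0)
    {S : Finset (Fin n)} (hS : S.card = k + 1) :
    ∃ w ∈ hermDual (Fintype.card F) (grsCode k a v), ∀ i, w i ≠ 0 ↔ i ∈ S := by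
  classical
  refine ⟨fun i => if i ∈ S then (Lagrange.nodalWeight S a i / v i) ^ Fintype.card F else 0,
    fun y hy => ?_, fun i => ?_⟩
  · obtain ⟨f, hf, hyf⟩ := mem_grsCode.1 hy
    have hsum := congrArg (FiniteField.frobeniusAlgHom F K)
      (sum_nodalWeight_mul_eval_eq_zero (s := S) (P := f) ha.injOn (by simpa [hS] using hf))
    rw [map_sum, map_zero] at hsum
    rw [hermInner, ← Finset.sum_subset S.subset_univ fun i _ hi => by rw [if_neg hi, zero_mul]]
    refine (Finset.sum_congr rfl fun i hi => ?_).trans hsum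
    rw [FiniteField.frobeniusAlgHom_apply, hyf, if_pos hi, ← mul_pow, ← mul_assoc,
      div_mul_cancel₀ _ (hv i)]
  · by_cases hi : i ∈ S
    · simp [hi, hv i, Lagrange.nodalWeight_ne_zero ha.injOn hi]
    · simp [hi]

lemma isLeast_hammingNorm_grsCode [DecidableEq K] (ha : Function.Injective a)
    (hv : ∀ i, v i ≠ 0) (hkn : 2 * k < n) :
    IsLeast (hammingNorm '' (hermDual (Fintype.card F) (grsCode k a v) \ grsCode k a v))
      (k + 1) := by
  refine ⟨?_, ?_⟩
  · obtain ⟨S, -, hS⟩ := Finset.exists_subset_card_eq (s := (Finset.univ : Finset (Fin n)))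
      (n := k + 1) (by rw [Finset.card_univ, Fintype.card_fin]; omega)
    obtain ⟨w, hw, hwS⟩ := exists_mem_hermDual_grsCode (F := F) ha hv hS
    have hnorm : hammingNorm w = k + 1 := by simp [hammingNorm, hwS, hS]
    refine ⟨w, ⟨hw, fun hwC => ?_⟩, hnorm⟩
    have := lt_add_hammingNorm_of_mem_grsCode ha hv hwC
      (hammingNorm_ne_zero_iff.1 (hnorm ▸ k.succ_ne_zero))
    omega
  · rintro _ ⟨w, ⟨hw, hwC⟩, rfl⟩
    exact lt_hammingNorm_of_mem_hermDual_grsCode ha hv Fintype.card_ne_zero hw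
      fun h0 => hwC (h0 ▸ zero_mem _)

lemma isHermSelfOrthogonal_span {X : Set (Fin n → K)}
    (hX : ∀ x ∈ X, ∀ y ∈ X, hermInner (Fintype.card F) x y = 0) :
    IsHermSelfOrthogonal (Fintype.card F) (Submodule.span K X) := by
  intro x hx y hy
  induction hx using Submodule.span_induction with
  | zero => simp [hermInner]
  | add x x' _ _ hx hx' =>
    simp only [hermInner, Pi.add_apply, add_mul, Finset.sum_add_distrib] at hx hx' ⊢
    rw [hx, hx', add_zero]
  | smul c x _ hx => rw [hermInner_smul_left, hx, mul_zero]
  | mem x hx =>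
    induction hy using Submodule.span_induction with
    | mem y hy => exact hX x hx y hy
    | zero => simp [hermInner, Fintype.card_ne_zero]
    | add y y' _ _ hy hy' =>
      simp only [hermInner, ← FiniteField.frobeniusAlgHom_apply F K] at hy hy' ⊢
      simp only [Pi.add_apply, map_add, mul_add, Finset.sum_add_distrib, hy, hy', add_zero]
    | smul c y _ hy => rw [hermInner_smul_right, hy, mul_zero]

lemma isHermSelfOrthogonal_grsCode
    (h : ∀ s < k, ∀ t < k,
      ∑ i, v i ^ (Fintype.card F + 1) * a i ^ (s + Fintype.card F * t) = 0) :
    IsHermSelfOrthogonal (Fintype.card F) (grsCode k a v) := by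
  rw [grsCode_eq_span]
  refine isHermSelfOrthogonal_span ?_
  rintro _ ⟨s, hs, rfl⟩ _ ⟨t, ht, rfl⟩
  rw [hermInner, ← h s hs t ht]
  exact Finset.sum_congr rfl fun i _ => by ring

theorem exists_quantumMDS_of_grsCode (hrank : Module.finrank F K = 2) [NeZero (2 : F)]
    (ha : Function.Injective a) (hv : ∀ i, v i ≠ 0) (hkn : 2 * k < n)
    (hself : IsHermSelfOrthogonal (Fintype.card F) (grsCode k a v)) :
    ∃ Q : Submodule ℂ (QuditSpace F n), IsHermitianConstruction (grsCode k a v) Q ∧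
      IsQuantumMDSCode Q (n - 2 * k) (k + 1) := by
  classical
  have : Module.Finite F K := Module.finite_of_finrank_eq_succ hrank
  let b : Module.Basis (Fin 2) F K := Module.finBasisOfFinrankEq F K hrank
  obtain ⟨ψ, hψ⟩ : ∃ ψ : AddChar F ℂ, ψ ≠ 1 :=
    (AddChar.exists_apply_ne_zero.2 (one_ne_zero (α := F))).imp fun ψ hψ h => hψ (h ▸ rfl)
  have hcode := isQuantumCode_stabilizerCode (b := b) hψ hself
    (isLeast_hammingNorm_grsCode (F := F) ha hv hkn)
  rw [finrank_grsCode ha hv (by omega)] at hcode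
  exact ⟨_, isHermitianConstruction_stabilizerCode hψ hself, hcode, by omega⟩

end GRS

/-! ### Locators in cosets of a subgroup -/

section Cosets

lemma sum_pow_mul_eq_ite {R : Type*} [CommRing R] [IsDomain R] {ζ : R} {m : ℕ}
    (hζ : IsPrimitiveRoot ζ m) (T : ℕ) :
    ∑ i : Fin m, ζ ^ ((i : ℕ) * T) = if m ∣ T then (m : R) else 0 := by
  simp only [mul_comm _ T, pow_mul]
  rw [Fin.sum_univ_eq_sum_range fun i => (ζ ^ T) ^ i]
  split_ifs with h
  · simp [(hζ.pow_eq_one_iff_dvd T).2 h]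
  · refine eq_zero_of_ne_zero_of_mul_right_eq_zero
      (sub_ne_zero.2 fun h1 => h ((hζ.pow_eq_one_iff_dvd T).1 h1)) ?_
    rw [geom_sum_mul, ← pow_mul, mul_comm, pow_mul, hζ.pow_eq_one, one_pow, sub_self]

variable {ι F K : Type*} [Field F] [Field K] [Algebra F K]

variable (F) in
lemma cast_orderOf_ne_zero [Finite K] (θ : Kˣ) : (orderOf θ : F) ≠ 0 := by
  have : NeZero (orderOf θ) := ⟨(orderOf_pos θ).ne'⟩
  have hθ : IsPrimitiveRoot (θ : K) (orderOf θ) :=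
    IsPrimitiveRoot.coe_units_iff.2 (IsPrimitiveRoot.orderOf θ)
  have := hθ.neZero'
  rw [← map_ne_zero (algebraMap F K), map_natCast]
  exact NeZero.ne _

variable {θ : Kˣ} {N m : ℕ} {e : ι → ℕ}

/-- The zero locator together with the elements of the cosets `θ ^ e l * ⟨θ ^ N⟩`, where `θ ^ N`
has order `m`. -/
noncomputable def cosetLocator (θ : Kˣ) (N m : ℕ) (e : ι → ℕ) : Option (ι × Fin m) → K
  | none => 0
  | some (l, ν) => θ ^ e l * (θ ^ N) ^ (ν : ℕ)

lemma cosetLocator_some_ne_zero (p : ι × Fin m) : cosetLocator θ N m e (some p) ≠ 0 :=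
  mul_ne_zero (pow_ne_zero _ θ.ne_zero) (pow_ne_zero _ (pow_ne_zero _ θ.ne_zero))

lemma cosetLocator_injective (hθ : orderOf θ = N * m) (hN : 0 < N)
    (he : ∀ l l', e l ≡ e l' [MOD N] → l = l') :
    Function.Injective (cosetLocator θ N m e) := by
  rintro (_ | ⟨l, ν⟩) (_ | ⟨l', ν'⟩) heq
  · rfl
  · exact absurd heq.symm (cosetLocator_some_ne_zero _)
  · exact absurd heq (cosetLocator_some_ne_zero _)
  · have hmod : e l + N * ν ≡ e l' + N * ν' [MOD N * m] := by
      rw [← hθ, ← pow_eq_pow_iff_modEq]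
      exact Units.ext (by simpa [cosetLocator, pow_add, pow_mul] using heq)
    obtain rfl : l = l' := he l l' (by simpa [Nat.ModEq] using hmod.of_mul_right m)
    have hν : (ν : ℕ) ≡ ν' [MOD m] :=
      Nat.ModEq.mul_left_cancel' hN.ne' (Nat.ModEq.add_left_cancel' _ hmod)
    rw [Fin.ext (hν.eq_of_lt_of_lt ν.2 ν'.2)]

lemma range_cosetLocator (hθ : orderOf θ = N * m) (hm : 0 < m) :
    Set.range (cosetLocator θ N m e) =
      {0} ∪ {x : K | ∃ l, ∃ ν : ℕ, x = θ ^ e l * (θ ^ N) ^ ν} := by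
  ext x
  refine ⟨?_, ?_⟩
  · rintro ⟨_ | ⟨l, ν⟩, rfl⟩
    · exact Or.inl rfl
    · exact Or.inr ⟨l, ν, rfl⟩
  · rintro (rfl | ⟨l, ν, rfl⟩)
    · exact ⟨none, rfl⟩
    · have hmod : θ ^ (N * (ν % m)) = θ ^ (N * ν) := by
        rw [pow_eq_pow_iff_modEq, hθ]
        exact (Nat.mod_modEq ν m).mul_left' N
      refine ⟨some (l, ⟨ν % m, Nat.mod_lt _ hm⟩), ?_⟩
      simp only [cosetLocator, ← pow_mul, ← Units.val_pow_eq_pow_val, hmod]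

variable [Fintype ι]

/-- The weights `w` on the cosets, extended by the weight of the zero locator that makes the total
weight vanish. -/
def cosetWeight (m : ℕ) (w : ι → F) : Option (ι × Fin m) → F
  | none => -(m * ∑ l, w l)
  | some (l, _) => w l

lemma cosetWeight_ne_zero {w : ι → F} (hm : (m : F) ≠ 0) (hw : ∀ l, w l ≠ 0) (hsum : ∑ l, w l ≠ 0) :
    ∀ o, cosetWeight m w o ≠ 0
  | none => neg_ne_zero.2 (mul_ne_zero hm hsum)
  | some (l, _) => hw l

lemma sum_coset_pow (hθ : orderOf θ = N * m) (hN : 0 < N) (w : ι → K) (M : ℕ) :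
    ∑ p : ι × Fin m, w p.1 * cosetLocator θ N m e (some p) ^ M =
      (∑ l, w l * (θ : K) ^ (e l * M)) * if m ∣ M then (m : K) else 0 := by
  have hγ : IsPrimitiveRoot ((θ : K) ^ N) m := by
    rw [← Units.val_pow_eq_pow_val, IsPrimitiveRoot.coe_units_iff, IsPrimitiveRoot.iff_orderOf,
      orderOf_pow_of_dvd hN.ne' ⟨m, hθ⟩, hθ, Nat.mul_div_cancel_left _ hN]
  rw [← sum_pow_mul_eq_ite hγ, Finset.sum_mul_sum, Fintype.sum_prod_type]
  refine Finset.sum_congr rfl fun l _ => Finset.sum_congr rfl fun ν _ => ?_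
  rw [cosetLocator, mul_pow, ← pow_mul, ← pow_mul _ (ν : ℕ), mul_assoc]

lemma sum_cosetWeight_mul_pow_eq_zero (hθ : orderOf θ = N * m) (hN : 0 < N) {w : ι → F} {M : ℕ}
    (hw : ∀ T ≠ 0, M = m * T → ∑ l, algebraMap F K (w l) * ((θ : K) ^ m) ^ (e l * T) = 0) :
    ∑ o, algebraMap F K (cosetWeight m w o) * cosetLocator θ N m e o ^ M = 0 := by
  rw [Fintype.sum_option]
  have hsum := sum_coset_pow (e := e) hθ hN (fun l => algebraMap F K (w l)) M
  simp only [cosetWeight] at hsum ⊢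
  rw [hsum]
  split_ifs with hM
  · obtain ⟨T, rfl⟩ := hM
    rcases eq_or_ne (m * T) 0 with h0 | h0
    · simp only [h0, mul_zero, pow_zero, mul_one, map_neg, map_mul, map_natCast, map_sum]
      ring
    · have hT := hw T (right_ne_zero_of_mul h0) rfl
      simp only [← pow_mul, mul_left_comm m] at hT
      rw [hT, cosetLocator, zero_pow h0, mul_zero, zero_mul, add_zero]
  · have h0 : M ≠ 0 := fun h0 => hM (h0 ▸ dvd_zero m)
    rw [cosetLocator, zero_pow h0, mul_zero, mul_zero, add_zero]

variable [Fintype F]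

lemma algebraMap_norm_eq_pow_card_add_one (hrank : Module.finrank F K = 2) (x : K) :
    algebraMap F K (Algebra.norm F x) = x ^ (Fintype.card F + 1) := by
  have : Module.Finite F K := Module.finite_of_finrank_eq_succ hrank
  have : Finite K := Module.finite_of_finite F
  rw [FiniteField.algebraMap_norm_eq_pow_sum, hrank, Finset.sum_range_succ, Finset.sum_range_one,
    pow_zero, pow_one, Nat.card_eq_fintype_card, add_comm]

theorem existsQuantumMDSFromGRS_of_weights (hrank : Module.finrank F K = 2) {h k : ℕ}
    (hθ : orderOf θ = 2 * h * m) (he : ∀ l l', e l ≡ e l' [MOD 2 * h] → l = l') {w : ι → F}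
    (hw : ∀ l, w l ≠ 0) (hsum : ∑ l, w l ≠ 0) (hk : 2 * k < Fintype.card ι * m + 1)
    (horth : ∀ s < k, ∀ t < k, ∀ T ≠ 0, s + Fintype.card F * t = m * T →
      ∑ l, algebraMap F K (w l) * ((θ : K) ^ m) ^ (e l * T) = 0) :
    ExistsQuantumMDSFromGRS F θ h (Fintype.card ι) (Fintype.card ι * m + 1) k := by
  have : Module.Finite F K := Module.finite_of_finrank_eq_succ hrank
  have : Finite K := Module.finite_of_finite F
  have hpos : 0 < 2 * h * m := hθ ▸ orderOf_pos θ
  have hh : 0 < 2 * h := Nat.pos_of_mul_pos_right hpos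
  have hcast : ((2 * h * m : ℕ) : F) ≠ 0 := hθ ▸ cast_orderOf_ne_zero F θ
  have : NeZero (2 : F) := ⟨fun h2 => hcast (by push_cast; rw [h2, zero_mul, zero_mul])⟩
  have hm : (m : F) ≠ 0 := fun hm => hcast (by push_cast; rw [hm, mul_zero])
  choose v hvnorm using FiniteField.norm_surjective F K
  have hv : ∀ x, v x ^ (Fintype.card F + 1) = algebraMap F K x := fun x => by
    rw [← algebraMap_norm_eq_pow_card_add_one hrank, hvnorm]
  let σ : Fin (Fintype.card ι * m + 1) ≃ Option (ι × Fin m) :=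
    (Fintype.equivFinOfCardEq (by simp)).symm
  let a := cosetLocator θ (2 * h) m e ∘ σ
  let u := fun i => v (cosetWeight m w (σ i))
  have ha : Function.Injective a := (cosetLocator_injective hθ hh he).comp σ.injective
  have hu : ∀ i, u i ≠ 0 := by
    intro i h0
    have := hv (cosetWeight m w (σ i))
    rw [show v _ = 0 from h0, zero_pow (Nat.succ_ne_zero _), eq_comm, map_eq_zero] at this
    exact cosetWeight_ne_zero hm hw hsum _ this
  have hself : IsHermSelfOrthogonal (Fintype.card F) (grsCode k a u) := by
    refine isHermSelfOrthogonal_grsCode fun s hs t ht => ?_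
    simp only [u, a, hv, Function.comp_apply]
    rw [Equiv.sum_comp σ fun o => algebraMap F K (cosetWeight m w o) *
      cosetLocator θ (2 * h) m e o ^ (s + Fintype.card F * t)]
    exact sum_cosetWeight_mul_pow_eq_zero hθ hh (horth s hs t ht)
  obtain ⟨Q, hQ, hQ'⟩ := exists_quantumMDS_of_grsCode hrank ha hu hk hself
  let l := (Fintype.equivFin ι).symm
  refine ⟨e ∘ l, a, u, Q, fun i j hij => l.injective (he _ _ hij), ha, ?_, hu, hself, hQ, hQ'⟩
  rw [σ.surjective.range_comp, range_cosetLocator hθ (Nat.pos_of_mul_pos_left hpos)]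
  simp only [Function.comp_apply, l.surjective.exists]

end Cosets

/-! ### Weights of the cosets -/

section Weights

open Polynomial

variable {F : Type*} [Field F]

lemma exists_nowhereZero_sum_mul_pow_eq_zero {ι : Type*} [Fintype ι] [Nonempty ι] {y : ι → F}
    (hy : Function.Injective y) (hy0 : ∀ l, y l ≠ 0) :
    ∃ w : ι → F, (∀ l, w l ≠ 0) ∧ ∑ l, w l ≠ 0 ∧
      ∀ T ≠ 0, T < Fintype.card ι → ∑ l, w l * y l ^ T = 0 := by
  classical
  -- The sums of the nodal weights of the nodes `0, y l` vanish for all `T < card ι`; the node `0`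
  -- contributes only for `T = 0`.
  let z : Option ι → F := fun o => o.elim 0 y
  have hz : Function.Injective z :=
    Option.injective_iff.2 ⟨hy, fun ⟨l, hl⟩ => hy0 l hl⟩
  let w : Option ι → F := Lagrange.nodalWeight Finset.univ z
  have hw : ∀ o, w o ≠ 0 := fun o => Lagrange.nodalWeight_ne_zero hz.injOn (Finset.mem_univ o)
  have hsum : ∀ T < Fintype.card ι, w none * 0 ^ T + ∑ l, w (some l) * y l ^ T = 0 := by
    intro T hT
    have := sum_nodalWeight_mul_eval_eq_zero (s := Finset.univ) (P := (X : F[X]) ^ T) hz.injOn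
      (by rw [degree_X_pow, Finset.card_univ, Fintype.card_option]; exact_mod_cast hT)
    rw [Fintype.sum_option] at this
    simp only [eval_pow, eval_X] at this
    exact this
  refine ⟨fun l => w (some l), fun l => hw _, fun h0 => ?_, fun T hT0 hT => ?_⟩
  · have := hsum 0 Fintype.card_pos
    simp only [pow_zero, mul_one, h0, add_zero] at this
    exact hw none this
  · have := hsum T hT
    rwa [zero_pow hT0, mul_zero, zero_add] at this

lemma exists_sum_mul_pow_eq {N : ℕ} {y : Fin N → F} (hy : Function.Injective y) (b : ℕ → F) :
    ∃ w : Fin N → F, ∀ T < N, ∑ i, w i * y i ^ T = b T := by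
  have hunit : IsUnit (Matrix.vandermonde y) :=
    (Matrix.isUnit_iff_isUnit_det _).2 (Matrix.det_vandermonde_ne_zero_iff.2 hy).isUnit
  obtain ⟨w, hw⟩ := Matrix.vecMul_surjective_iff_isUnit.2 hunit fun T => b T
  exact ⟨w, fun T hT => congrFun hw ⟨T, hT⟩⟩

lemma exists_forall_add_mul_ne_zero {ι : Type*} [Fintype ι] [Fintype F]
    (hι : Fintype.card ι < Fintype.card F) {x y : ι → F} (hy : ∀ i, y i ≠ 0) :
    ∃ α : F, ∀ i, x i + α * y i ≠ 0 := by
  obtain ⟨α, hα⟩ : ∃ α, ∀ i, -x i / y i ≠ α := by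
    by_contra! hsurj
    exact hι.not_ge (Fintype.card_le_of_surjective _ hsurj)
  refine ⟨α, fun i h => hα i ?_⟩
  rw [div_eq_iff (hy i)]
  linear_combination -h

/-- Adding a multiple of the nodal weights, which have no zeros, changes only the last power sum. -/
lemma exists_nowhereZero_sum_mul_pow_eq [Fintype F] {N : ℕ} (hN : N < Fintype.card F)
    {y : Fin N → F} (hy : Function.Injective y) (b : ℕ → F) :
    ∃ w : Fin N → F, (∀ i, w i ≠ 0) ∧ ∀ T, T + 1 < N → ∑ i, w i * y i ^ T = b T := by
  obtain ⟨w, hw⟩ := exists_sum_mul_pow_eq hy b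
  obtain ⟨α, hα⟩ := exists_forall_add_mul_ne_zero (x := w) (by rwa [Fintype.card_fin])
    fun i => Lagrange.nodalWeight_ne_zero hy.injOn (Finset.mem_univ i)
  refine ⟨_, hα, fun T hT => ?_⟩
  have hnodal := sum_nodalWeight_mul_eval_eq_zero (s := Finset.univ) (P := (X : F[X]) ^ T) hy.injOn
    (by
      rw [degree_X_pow, Finset.card_univ, Fintype.card_fin]
      exact_mod_cast Nat.lt_sub_of_add_lt hT)
  simp only [eval_pow, eval_X] at hnodal
  simp only [add_mul, Finset.sum_add_distrib, mul_assoc, ← Finset.mul_sum, hnodal, mul_zero,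
    add_zero, hw T (by omega)]

end Weights

section ParityWeights

/-- The exponents `0, 2, …, 4 g - 2` and `1, 3, …, 2 s - 1`. -/
def parityExponent (g s : ℕ) : Fin (2 * g) ⊕ Fin s → ℕ :=
  Sum.elim (fun i => 2 * i) fun j => 2 * j + 1

lemma parityExponent_eq_of_modEq {g s : ℕ} (hs : s ≤ 2 * g) (l l' : Fin (2 * g) ⊕ Fin s)
    (h : parityExponent g s l ≡ parityExponent g s l' [MOD 2 * (2 * g)]) : l = l' := by
  have hlt : ∀ l, parityExponent g s l < 2 * (2 * g) := by
    rintro (i | j) <;> simp only [parityExponent, Sum.elim_inl, Sum.elim_inr] <;> omega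
  have heq := h.eq_of_lt_of_lt (hlt l) (hlt l')
  rcases l with i | i <;> rcases l' with j | j <;>
    simp only [parityExponent, Sum.elim_inl, Sum.elim_inr] at heq
  · exact congrArg _ (Fin.ext (by omega))
  · omega
  · omega
  · exact congrArg _ (Fin.ext (by omega))

variable {F K : Type*} [Field F] [Field K] [Algebra F K] {g s : ℕ} {ζ : F}

lemma pow_half_eq_neg_one (hg : 0 < g) (hζ : IsPrimitiveRoot ζ (2 * g)) : ζ ^ g = -1 := by
  have hsq : (ζ ^ g) ^ 2 = 1 := by rw [← pow_mul, mul_comm, hζ.pow_eq_one]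
  exact (sq_eq_one_iff.1 hsq).resolve_left (hζ.pow_ne_one_of_pos_of_lt hg.ne' (by omega))

lemma sum_mul_pow_add {ι : Type*} [Fintype ι] {N : ℕ} (hζ : ζ ^ N = 1) (w : ι → F) (i : ι → ℕ)
    (T : ℕ) : ∑ l, w l * (ζ ^ i l) ^ (N + T) = ∑ l, w l * (ζ ^ i l) ^ T := by
  simp only [pow_add, pow_right_comm ζ _ N, hζ, one_pow, one_mul]

/-- With `U T` and `V T` the power sums of the weights `u` and `v` on the powers of `ζ`, the
weights `v` are chosen such that `V T + ω ^ T * U T`, where `ω ^ 2 = ζ`, vanishes for even `T`. -/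
lemma exists_parityWeights [Fintype F] (hζ : IsPrimitiveRoot ζ (2 * g))
    (hg : 2 * g < Fintype.card F) (hs0 : 0 < s) (hs : s ≤ 2 * g) :
    ∃ (v : Fin (2 * g) → F) (u : Fin s → F), (∀ i, v i ≠ 0) ∧ (∀ j, u j ≠ 0) ∧ ∑ j, u j ≠ 0 ∧
      ∑ i, v i = ∑ j, u j ∧ (∀ T ≠ 0, T < s → ∑ j, u j * (ζ ^ (j : ℕ)) ^ T = 0) ∧
      ∀ T ≠ 0, T + 1 < 2 * g →
        ∑ i, v i * (ζ ^ (i : ℕ)) ^ T = -(ζ ^ (T / 2) * ∑ j, u j * (ζ ^ (j : ℕ)) ^ T) := by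
  have hinj : ∀ N ≤ 2 * g, Function.Injective fun i : Fin N => ζ ^ (i : ℕ) := fun N hN i j hij =>
    Fin.ext (hζ.pow_inj (i.2.trans_le hN) (j.2.trans_le hN) hij)
  have : Nonempty (Fin s) := ⟨⟨0, hs0⟩⟩
  obtain ⟨u, hu, hu0, hU⟩ := exists_nowhereZero_sum_mul_pow_eq_zero (hinj s hs)
    fun j => pow_ne_zero _ (hζ.ne_zero (by omega))
  rw [Fintype.card_fin] at hU
  obtain ⟨v, hv, hV⟩ := exists_nowhereZero_sum_mul_pow_eq hg (hinj _ le_rfl) fun T =>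
    if T = 0 then ∑ j, u j else -(ζ ^ (T / 2) * ∑ j, u j * (ζ ^ (j : ℕ)) ^ T)
  refine ⟨v, u, hv, hu, hu0, ?_, hU, fun T hT0 hT => (hV T hT).trans (if_neg hT0)⟩
  simpa using hV 0 (by omega)

lemma exists_weights_parityExponent [Fintype F] {ω : K} (hζ : IsPrimitiveRoot ζ (2 * g))
    (hω : algebraMap F K ζ = ω ^ 2) (hg : 2 * g < Fintype.card F) (hs0 : 0 < s) (hs : s ≤ 2 * g) :
    ∃ w : Fin (2 * g) ⊕ Fin s → F, (∀ l, w l ≠ 0) ∧ ∑ l, w l ≠ 0 ∧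
      ∀ T ≠ 0, (Even T ∧ T ≤ 2 * g ∨ T < s ∧ T + 1 < 2 * g ∨
          2 * g < T ∧ T < 2 * g + s ∧ T + 1 < 2 * g + 2 * g) →
        ∑ l, algebraMap F K (w l) * ω ^ (parityExponent g s l * T) = 0 := by
  obtain ⟨v, u, hv, hu, hu0, hvu, hU, hV⟩ := exists_parityWeights hζ hg hs0 hs
  refine ⟨Sum.elim v u, by rintro (i | j) <;> simp [hv, hu], ?_, fun T hT0 hT => ?_⟩
  · have : NeZero (2 * g) := ⟨by omega⟩
    have h2 : (2 : F) ≠ 0 := by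
      have := hζ.neZero'.ne
      rw [Nat.cast_mul, Nat.cast_ofNat] at this
      exact left_ne_zero_of_mul this
    simpa [Fintype.sum_sum_type, hvu, ← two_mul] using And.intro h2 hu0
  let U : ℕ → F := fun T => ∑ j, u j * (ζ ^ (j : ℕ)) ^ T
  let V : ℕ → F := fun T => ∑ i, v i * (ζ ^ (i : ℕ)) ^ T
  have hsum : ∑ l, algebraMap F K (Sum.elim v u l) * ω ^ (parityExponent g s l * T) =
      algebraMap F K (V T) + ω ^ T * algebraMap F K (U T) := by
    simp only [Fintype.sum_sum_type, parityExponent, Sum.elim_inl, Sum.elim_inr, V, U, map_sum,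
      Finset.mul_sum, map_mul, map_pow, hω]
    congr 1 <;> exact Finset.sum_congr rfl fun i _ => by ring
  have hzero : ∀ T ≠ 0, T < s → T + 1 < 2 * g → U T = 0 ∧ V T = 0 := fun T hT0 hTs hTg =>
    ⟨hU T hT0 hTs, by simp only [V, hV T hT0 hTg, hU T hT0 hTs, mul_zero, neg_zero]⟩
  rw [hsum]
  rcases hT with ⟨⟨S, rfl⟩, hS⟩ | ⟨hTs, hTg⟩ | ⟨hgT, hTs, hTg⟩
  · suffices h : V (S + S) = -(ζ ^ S * U (S + S)) by
      rw [h, ← two_mul, pow_mul, ← hω, map_neg, map_mul, map_pow, neg_add_cancel]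
    rcases (show S ≤ g by omega).lt_or_eq with hSg | rfl
    · refine (hV _ hT0 (by omega)).trans ?_
      rw [← two_mul, Nat.mul_div_cancel_left _ two_pos]
    · rw [← two_mul, ← add_zero (2 * S)]
      simp only [V, U, sum_mul_pow_add hζ.pow_eq_one, pow_half_eq_neg_one (by omega) hζ]
      simp [hvu]
  · rw [(hzero T hT0 hTs hTg).1, (hzero T hT0 hTs hTg).2, map_zero, mul_zero, add_zero]
  · obtain ⟨T, rfl⟩ := Nat.exists_eq_add_of_lt hgT
    have := hzero (T + 1) T.succ_ne_zero (by omega) (by omega)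
    simp only [U, V] at this ⊢
    rw [add_assoc, sum_mul_pow_add hζ.pow_eq_one, sum_mul_pow_add hζ.pow_eq_one, this.1, this.2,
      map_zero, mul_zero, add_zero]

end ParityWeights

/-! ### The exponents that occur in the orthogonality relations -/

section Exponents

lemma le_of_mul_le_mul_add {S ρ c τ : ℕ} (hτ : τ < c) (h : S * c ≤ ρ * c + τ) : S ≤ ρ := by
  have : S * c < (ρ + 1) * c := by rw [add_one_mul]; omega
  exact Nat.le_of_lt_succ (lt_of_mul_lt_mul_right this c.zero_le)

variable {g c τ ρ s t S : ℕ}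

lemma le_of_add_mul_eq_even_mul (hτ : τ < c) (hs : s ≤ ρ * c + τ) (ht : t ≤ ρ * c + τ)
    (h : s + (2 * g * c + 1) * t = c * (g * c + 1) * (2 * S)) : S ≤ ρ := by
  refine le_of_mul_le_mul_add hτ (le_of_mul_le_mul_right ?_ (2 * g * c + 1).succ_pos)
  calc S * c * (2 * g * c + 1 + 1) = s + (2 * g * c + 1) * t := by rw [h]; ring
    _ ≤ (ρ * c + τ) + (2 * g * c + 1) * (ρ * c + τ) := by gcongr
    _ = (ρ * c + τ) * (2 * g * c + 1 + 1) := by ring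

/-- With `A = S c + τ` and `q = 2 g c + 1`, the right-hand side is `(A + g c + 1) + q A`. Unless
`A + g c + 1 ≥ q`, comparing last `q`-adic digits gives `s = A + g c + 1`. -/
lemma lt_and_of_add_mul_eq_odd_mul (hc : c = 2 * τ + 1) (hρ : ρ < 2 * g) (hs : s ≤ ρ * c + τ)
    (ht : t ≤ ρ * c + τ) (h : s + (2 * g * c + 1) * t = c * (g * c + 1) * (2 * S + 1)) :
    S < ρ ∧ (S + g < ρ ∨ g ≤ S) := by
  have hτ : τ < c := by omega
  have hdigits : s + (2 * g * c + 1) * t =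
      (S * c + τ + g * c + 1) + (2 * g * c + 1) * (S * c + τ) := by rw [h, hc]; ring
  have hSρ : S * c + τ < ρ * c + τ := by
    by_contra! hle
    have := Nat.mul_le_mul_left (2 * g * c + 1) (ht.trans hle)
    omega
  refine ⟨lt_of_mul_lt_mul_right (Nat.lt_of_add_lt_add_right hSρ) c.zero_le, ?_⟩
  rcases lt_or_ge (S * c + τ + g * c + 1) (2 * g * c + 1) with hlt | hge
  · have hs_lt : s < 2 * g * c + 1 := by
      have : (ρ + 1) * c ≤ 2 * g * c := Nat.mul_le_mul_right c hρ
      rw [add_one_mul] at this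
      omega
    have hmod : s ≡ S * c + τ + g * c + 1 [MOD 2 * g * c + 1] := by
      simpa only [Nat.ModEq, Nat.add_mul_mod_self_left] using
        congrArg (· % (2 * g * c + 1)) hdigits
    have hs_eq := hmod.eq_of_lt_of_lt hs_lt hlt
    refine Or.inl (lt_of_mul_lt_mul_right (?_ : (S + g) * c < ρ * c) c.zero_le)
    rw [add_mul]
    omega
  · refine Or.inr (le_of_mul_le_mul_add hτ ?_)
    rw [mul_assoc] at hge
    omega

lemma even_or_odd_exponent (hc : c = 2 * τ + 1) (hρ : ρ < 2 * g) {T : ℕ} (hs : s ≤ ρ * c + τ)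
    (ht : t ≤ ρ * c + τ) (h : s + (2 * g * c + 1) * t = c * (g * c + 1) * T) :
    ∃ S, T = 2 * S ∧ S ≤ ρ ∨ T = 2 * S + 1 ∧ S < ρ ∧ (S + g < ρ ∨ g ≤ S) := by
  obtain ⟨S, rfl | rfl⟩ := T.even_or_odd'
  · exact ⟨S, Or.inl ⟨rfl, le_of_add_mul_eq_even_mul (by omega) hs ht h⟩⟩
  · exact ⟨S, Or.inr ⟨rfl, lt_and_of_add_mul_eq_odd_mul hc hρ hs ht h⟩⟩

end Exponents

/-! ### The two ranges of the number of cosets -/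

section Ranges

variable {F K : Type*} [Field F] [Fintype F] [Field K] [Algebra F K]
  {g c τ ρ r k : ℕ} {θ : Kˣ}

lemma exists_isPrimitiveRoot_algebraMap_eq (hrank : Module.finrank F K = 2) {h m c : ℕ}
    (hθ : orderOf θ = 2 * h * m) (hh : 0 < h) (hm : 0 < m)
    (hc : c * (Fintype.card F + 1) = 2 * m) :
    ∃ ζ : F, IsPrimitiveRoot ζ h ∧ algebraMap F K ζ = ((θ : K) ^ m) ^ 2 := by
  have hnorm : algebraMap F K (Algebra.norm F ((θ : K) ^ c)) = ((θ : K) ^ m) ^ 2 := by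
    rw [algebraMap_norm_eq_pow_card_add_one hrank, ← pow_mul, ← pow_mul, hc, mul_comm]
  refine ⟨_, IsPrimitiveRoot.of_map_of_injective (f := algebraMap F K) ?_
    (algebraMap F K).injective, hnorm⟩
  rw [hnorm, ← pow_mul]
  have hθ' : IsPrimitiveRoot (θ : K) (2 * h * m) := by
    rw [IsPrimitiveRoot.coe_units_iff, ← hθ]
    exact IsPrimitiveRoot.orderOf θ
  exact hθ'.pow (by positivity) (by ring)

lemma existsQuantumMDSFromGRS_of_le (hrank : Module.finrank F K = 2) (hg : 0 < g)
    (hc : c = 2 * τ + 1) (hF : Fintype.card F = 2 * g * c + 1)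
    (hθ : orderOf θ = 2 * (2 * g) * (c * (g * c + 1))) (hρr : ρ < r) (hρg : ρ ≤ g)
    (hr : r ≤ 2 * g) (hk : k ≤ ρ * c + τ + 1) (hkn : 2 * k < r * (c * (g * c + 1)) + 1) :
    ExistsQuantumMDSFromGRS F θ (2 * g) r (r * (c * (g * c + 1)) + 1) k := by
  obtain ⟨ζ, hζ, hζω⟩ := exists_isPrimitiveRoot_algebraMap_eq (c := c) hrank hθ
    (by omega) (by rw [hc]; positivity) (by rw [hF]; ring)
  have : Nonempty (Fin r) := ⟨⟨0, by omega⟩⟩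
  obtain ⟨w, hw, hsum, hzero⟩ := exists_nowhereZero_sum_mul_pow_eq_zero
    (y := fun l : Fin r => ζ ^ (l : ℕ))
    (fun l l' h => Fin.ext (hζ.pow_inj (by omega) (by omega) h))
    (fun l => pow_ne_zero _ (hζ.ne_zero (by omega)))
  rw [Fintype.card_fin] at hzero
  have hexp : ∀ l l' : Fin r, (l : ℕ) ≡ l' [MOD 2 * (2 * g)] → l = l' := fun l l' h =>
    Fin.ext (h.eq_of_lt_of_lt (by omega) (by omega))
  have := existsQuantumMDSFromGRS_of_weights (k := k) hrank hθ hexp hw hsum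
    (by rwa [Fintype.card_fin]) fun s hs t ht T hT0 hT => ?_
  · rwa [Fintype.card_fin] at this
  rw [hF] at hT
  obtain ⟨S, ⟨rfl, hS⟩ | ⟨-, hS⟩⟩ :=
    even_or_odd_exponent (ρ := ρ) hc (by omega) (by omega) (by omega) hT
  · have hS0 := congrArg (algebraMap F K) (hzero S (by omega) (by omega))
    simp only [map_sum, map_mul, map_pow, hζω, map_zero] at hS0
    refine (Finset.sum_congr rfl fun l _ => ?_).trans hS0
    simp only [← pow_mul]
    congr 2
    ring
  · omega

lemma existsQuantumMDSFromGRS_add (hrank : Module.finrank F K = 2) (hc : c = 2 * τ + 1)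
    (hF : Fintype.card F = 2 * g * c + 1) (hθ : orderOf θ = 2 * (2 * g) * (c * (g * c + 1)))
    {s : ℕ} (hs0 : 0 < s) (hs : s ≤ 2 * g)
    (hρ : 2 * ρ + 1 ≤ 2 * g + s) (hk : k ≤ ρ * c + τ + 1)
    (hkn : 2 * k < (2 * g + s) * (c * (g * c + 1)) + 1) :
    ExistsQuantumMDSFromGRS F θ (2 * g) (2 * g + s) ((2 * g + s) * (c * (g * c + 1)) + 1) k := by
  obtain ⟨ζ, hζ, hζω⟩ := exists_isPrimitiveRoot_algebraMap_eq (c := c) hrank hθ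
    (by omega) (by rw [hc]; positivity) (by rw [hF]; ring)
  have hgF : 2 * g < Fintype.card F := by rw [hF, hc]; nlinarith
  obtain ⟨w, hw, hsum, hzero⟩ := exists_weights_parityExponent hζ hζω hgF hs0 hs
  have hcard : Fintype.card (Fin (2 * g) ⊕ Fin s) = 2 * g + s := by
    rw [Fintype.card_sum, Fintype.card_fin, Fintype.card_fin]
  have := existsQuantumMDSFromGRS_of_weights (k := k) hrank hθ (parityExponent_eq_of_modEq hs) hw
    hsum (by rwa [hcard]) fun a ha b hb T hT0 hT => ?_
  · rwa [hcard] at this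
  rw [hF] at hT
  refine hzero T hT0 ?_
  obtain ⟨S, ⟨rfl, hS⟩ | ⟨rfl, hSρ, hS⟩⟩ :=
    even_or_odd_exponent (ρ := ρ) hc (by omega) (by omega) (by omega) hT
  · rcases le_or_gt S g with hSg | hgS
    · exact Or.inl ⟨even_two_mul S, by omega⟩
    · exact Or.inr (Or.inr (by omega))
  · exact Or.inr (by omega)

lemma existsQuantumMDSFromGRS_of_card_eq (hrank : Module.finrank F K = 2) (hc : c = 2 * τ + 1)
    (hF : Fintype.card F = 2 * g * c + 1) (hθ : orderOf θ = 2 * (2 * g) * (c * (g * c + 1)))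
    (hρr : ρ < r) (hρ : 2 * ρ + 1 ≤ max (2 * g + 1) r) (hr : r ≤ 2 * (2 * g))
    (hk : k ≤ ρ * c + τ + 1) :
    ExistsQuantumMDSFromGRS F θ (2 * g) r (r * (c * (g * c + 1)) + 1) k := by
  have hg : 0 < g := by omega
  have hkn : 2 * k < r * (c * (g * c + 1)) + 1 := by
    have hgc : 1 ≤ g * c := Nat.mul_pos hg (by omega)
    have hle : 2 * (ρ + 1) * c ≤ r * (c * (g * c + 1)) := by
      rw [mul_comm c, ← mul_assoc]
      exact Nat.mul_le_mul_right c (by nlinarith)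
    have : 2 * (ρ + 1) * c = 2 * (ρ * c) + 2 * c := by ring
    omega
  rcases le_or_gt r (2 * g) with hrg | hgr
  · exact existsQuantumMDSFromGRS_of_le hrank hg hc hF hθ hρr (by omega) hrg hk hkn
  · obtain ⟨s, rfl⟩ := Nat.exists_eq_add_of_lt hgr
    exact existsQuantumMDSFromGRS_add hrank hc hF hθ s.succ_pos (by omega) (by omega) hk hkn

end Ranges

lemma finrank_eq_two_of_card_eq_sq {F K : Type*} [Field F] [Fintype F] [Field K] [Fintype K]
    [Algebra F K] (hK : Fintype.card K = Fintype.card F ^ 2) : Module.finrank F K = 2 :=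
  Nat.pow_right_injective (a := Fintype.card F) Fintype.one_lt_card
    ((Module.card_eq_pow_finrank (K := F) (V := K)).symm.trans hK)

lemma eq_add_one_of_sub_one_div_eq {q g c : ℕ} (hc : c ≠ 0)
    (h : ((q : ℚ) - 1) / (2 * g : ℕ) = c) : 0 < g ∧ q = 2 * g * c + 1 := by
  have hg : (g : ℚ) ≠ 0 := by
    rintro hg
    rw [Nat.cast_mul, hg, mul_zero, div_zero] at h
    exact hc (Nat.cast_eq_zero.1 h.symm)
  refine ⟨Nat.pos_of_ne_zero (Nat.cast_ne_zero.1 hg), ?_⟩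
  rw [Nat.cast_mul, Nat.cast_ofNat, div_eq_iff (mul_ne_zero two_ne_zero hg)] at h
  have : (q : ℚ) = 2 * g * c + 1 := by linear_combination h
  exact_mod_cast this

lemma eq_mul_add_one_of_cast_eq {g c r n : ℕ} (hg : 0 < g)
    (hn : (n : ℚ) = r * (((2 * g * c + 1 : ℕ) : ℚ) ^ 2 - 1) / (2 * (2 * g : ℕ)) + 1) :
    n = r * (c * (g * c + 1)) + 1 := by
  have hgQ : (g : ℚ) ≠ 0 := Nat.cast_ne_zero.2 hg.ne'
  have : (n : ℚ) = r * (c * (g * c + 1)) + 1 := by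
    rw [hn]
    push_cast
    field_simp
    ring
  exact_mod_cast this

lemma le_add_one_of_cast_le {g c τ ρ k : ℕ} (hg : 0 < g) (hc : c = 2 * τ + 1)
    (hk : (k : ℚ) ≤
      (2 * ρ + 1 : ℕ) * ((((2 * g * c + 1 : ℕ) : ℚ) - 1) / (2 * (2 * g : ℕ))) + 1 / 2) :
    k ≤ ρ * c + τ + 1 := by
  have hgQ : (g : ℚ) ≠ 0 := Nat.cast_ne_zero.2 hg.ne'
  have hhalf : (((2 * g * c + 1 : ℕ) : ℚ) - 1) / (2 * (2 * g : ℕ)) = c / 2 := by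
    push_cast
    field_simp
    ring
  have : (k : ℚ) ≤ ρ * c + τ + 1 := by
    refine hk.trans_eq ?_
    rw [hhalf, hc]
    push_cast
    ring
  exact_mod_cast this

lemma orderOf_eq_of_forall_mem_zpowers {K : Type*} [Field K] [Fintype K] {g c : ℕ}
    (hK : Fintype.card K = (2 * g * c + 1) ^ 2) {θ : Kˣ}
    (hθ : ∀ x : Kˣ, x ∈ Subgroup.zpowers θ) : orderOf θ = 2 * (2 * g) * (c * (g * c + 1)) := by
  rw [orderOf_eq_card_of_forall_mem_zpowers hθ, Nat.card_units, Nat.card_eq_fintype_card, hK,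
    Nat.sub_eq_iff_eq_add (Nat.one_le_pow' _ _)]
  ring

theorem theorem3p2_general {F K : Type*} [Field F] [Fintype F] [Field K] [Fintype K] [Algebra F K]
    (q h τ r R n k : ℕ) (hF : Fintype.card F = q) (hK : Fintype.card K = q ^ 2)
    (θ : Kˣ) (hθ : ∀ x : Kˣ, x ∈ Subgroup.zpowers θ) (hh : Even h)
    (hqh : ((q : ℚ) - 1) / h = 2 * τ + 1)
    (hn : (n : ℚ) = r * ((q : ℚ) ^ 2 - 1) / (2 * h) + 1)
    (hR : Odd R) (hRr : R < 2 * r) (hRh : R ≤ max (h + 1) r) (hr : r ≤ 2 * h)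
    (hk : (k : ℚ) ≤ R * ((q - 1) / (2 * h)) + 1 / 2) :
    ExistsQuantumMDSFromGRS F θ h r n k := by
  obtain ⟨g, rfl⟩ := hh.exists_two_nsmul
  obtain ⟨ρ, rfl⟩ := hR
  rw [smul_eq_mul] at *
  obtain ⟨c, hc⟩ : ∃ c, c = 2 * τ + 1 := ⟨_, rfl⟩
  have hcQ : (c : ℚ) = 2 * τ + 1 := by exact_mod_cast hc
  obtain ⟨hg, rfl⟩ := eq_add_one_of_sub_one_div_eq (by omega) (hqh.trans hcQ.symm)
  obtain rfl := eq_mul_add_one_of_cast_eq hg hn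
  have hrank : Module.finrank F K = 2 := finrank_eq_two_of_card_eq_sq (by rw [hK, hF])
  exact existsQuantumMDSFromGRS_of_card_eq hrank hc hF (orderOf_eq_of_forall_mem_zpowers hK hθ)
    (by omega) hRh hr (le_add_one_of_cast_le hg hc hk)

theorem theorem3p2 {F K : Type*} [Field F] [Fintype F] [Field K] [Fintype K] [Algebra F K]
    (q h τ r n k : ℕ) (hF : Fintype.card F = q) (hK : Fintype.card K = q ^ 2)
    (θ : Kˣ) (hθ : ∀ x : Kˣ, x ∈ Subgroup.zpowers θ)
    (hq : Odd q) (hh : Even h) (hτ : 1 ≤ τ)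
    (hqh : ((q : ℚ) - 1) / h = 2 * τ + 1)
    (hn : (n : ℚ) = r * ((q : ℚ) ^ 2 - 1) / (2 * h) + 1) :
    ((h : ℚ) / 2 + 1 ≤ r → r ≤ h →
      1 ≤ k → (k : ℚ) ≤ (h + 1) * ((q - 1) / (2 * h)) + 1 / 2 →
      ExistsQuantumMDSFromGRS F θ h r n k) ∧
    (Odd r → h < r → r < 2 * h →
      1 ≤ k → (k : ℚ) ≤ r * ((q - 1) / (2 * h)) + 1 / 2 →
      ExistsQuantumMDSFromGRS F θ h r n k) := by
  refine ⟨fun hr hrh _ hk => ?_, fun hodd hhr hr _ hk => ?_⟩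
  · have hr' : h + 1 < 2 * r := by
      have : (h : ℚ) + 1 < 2 * r := by linarith
      exact_mod_cast this
    exact theorem3p2_general q h τ r (h + 1) n k hF hK θ hθ hh hqh hn hh.add_one hr'
      (le_max_left _ _) (by omega) (by exact_mod_cast hk)
  · exact theorem3p2_general q h τ r r n k hF hK θ hθ hh hqh hn hodd (by omega) (le_max_right _ _)
      hr.le hk
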